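/- Let $(\Omega,\mathcal F,P)$ be a probability space with a filtration $(\mathcal F_t)_{t\in[0,T]}$, $T<\infty$, and let $p\in[1,\infty]$. A *fully-dynamic risk measure* is a family $(\rho_{st})_{0\le s\le t\le T}$ of maps $\rho_{st}:L^p(\mathcal F_t)\to L^p(\mathcal F_s)$ such that, for all $X,Y\in L^p(\mathcal F_t)$: $\rho_{st}(X)\le\rho_{st}(Y)$ if $X\ge Y$; $\rho_{st}(\lambda X+(1-\lambda)Y)\le\lambda\rho_{st}(X)+(1-\lambda)\rho_{st}(Y)$ for $\lambda\in[0,1]$; $\rho_{st}(X+Z)=\rho_{st}(X)-Z$ for $Z\in L^p(\mathcal F_s)$; and, if $p=\infty$, $\rho_{st}(X_n)\to\rho_{st}(X)$ almost surely whenever $X_n\uparrow X$ almost surely in $L^\infty(\mathcal F_t)$. It is *weakly time-consistent* if $\rho_{su}(\rho_{tu}(0)-\rho_{tu}(X))=\rho_{su}(X)$ for all $s\le t\le u$ and $X\in L^p(\mathcal F_u)$. Let $\mathcal Q_{st}$ be the set of probability measures $Q$ on $\mathcal F_t$ with $Q\ll P$ and $Q=P$ on $\mathcal F_s$. For $Q\in\mathcal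 Q_{st}$ let $$\alpha_{st}(Q)=\operatorname{ess\,sup}_{X\in L^p(\mathcal F_t)}\{E_Q[-X\mid\mathcal F_s]-\rho_{st}(X)\}\in(-\infty,+\infty]$$ be the minimal penalty, where $E_Q[Y\mid\mathcal F_s]=E_Q[Y^+\mid\mathcal F_s]-E_Q[Y^-\mid\mathcal F_s]$, with $\infty-\infty=-\infty$. A measure $Q\in\mathcal Q_{st}$ is an *optimal scenario for $X$* in the dual representation $\rho_{st}(X)=\operatorname{ess\,max}_{Q\in\mathcal Q_{st}}\{E_Q[-X\mid\mathcal F_s]-\alpha_{st}(Q)\}$ if $\rho_{st}(X)=E_Q[-X\mid\mathcal F_s]-\alpha_{st}(Q)$ a.s. For $s\le t\le u$, $Q\in\mathcal Q_{su}$ and $R\in\mathcal Q_{tu}$, let $S=Q|_{\mathcal F_t}\cdot R$ be the measure on $\mathcal F_u$ with $\frac{dS}{dP}=\frac{dQ|_{\mathcal F_t}}{dP}\,\frac{dR}{dP}$; then $S\in\mathcal Q_{su}$. Moreover: (a) If, for all $s\le t\le u$, $Q\in\mathcal Q_{su}$ and $R\in\mathcal Q_{tu}$, with $S=Q|_{\mathcal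 F_t}\cdot R$, $$\alpha_{su}(S)=\alpha_{su}(Q)+E_Q\Big[\alpha_{tu}(R)-\operatorname{ess\,inf}_{\bar R\in\mathcal Q_{tu}}\alpha_{tu}(\bar R)\,\Big|\,\mathcal F_s\Big]\quad\text{a.s.},$$ then $(\rho_{st})$ is weakly time-consistent. (b) If $(\rho_{st})$ is weakly time-consistent, then, for all $s\le t\le u$, $Q\in\mathcal Q_{su}$ and $R\in\mathcal Q_{tu}$, with $S=Q|_{\mathcal F_t}\cdot R$, $$\alpha_{su}(S)\le\alpha_{su}(Q)+E_Q\Big[\alpha_{tu}(R)-\operatorname{ess\,inf}_{\bar R\in\mathcal Q_{tu}}\alpha_{tu}(\bar R)\,\Big|\,\mathcal F_s\Big]\quad\text{a.s.}$$ Equality holds at the optimal scenarios: for every $X\in L^p(\mathcal F_u)$, equality holds a.s. whenever $R\in\mathcal Q_{tu}$ is an optimal scenario for $X$ in the dual representation of $\rho_{tu}$ and $Q\in\mathcal Q_{su}$ is an optimal scenario for $\rho_{tu}(0)-\rho_{tu}(X)$ in the dual representation of $\rho_{su}$; and such optimal $Q$ and $R$, with $E_P[\alpha_{su}(Q)]<\infty$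 and $E_P[\alpha_{tu}(R)]<\infty$, exist for every $X$. -/

import Mathlib

open MeasureTheory ProbabilityTheory Filter Topology
open scoped ENNReal

namespace FullyDynamic

/-! ### Essential suprema and infima of families of functions -/

section EssSup

variable {Ω : Type*} {ι : Type*}

/-- `g` is an essential supremum of the (arbitrary, possibly uncountable) family `f` of extended
real functions on the measure space `(Ω, m, μ)`: the almost surely least `m`-measurable function
that dominates every member of the family almost surely. -/
structure IsEssSup {m : MeasurableSpace Ω} (μ : Measure Ω) (f : ι → Ω → EReal)
    (g : Ω → EReal) : Prop where
  measurable : Measurable g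
  le : ∀ i, f i ≤ᵐ[μ] g
  least : ∀ h : Ω → EReal, Measurable h → (∀ i, f i ≤ᵐ[μ] h) → g ≤ᵐ[μ] h

theorem exists_isEssSup {m : MeasurableSpace Ω} (μ : Measure Ω) [IsFiniteMeasure μ]
    (f : ι → Ω → EReal) : ∃ g, IsEssSup μ f g := by
  classical
  set ψ : EReal → ℝ≥0∞ := fun x => (1 + EReal.exp x)⁻¹ with hψ
  have hψm : Measurable ψ := (measurable_const.add EReal.measurable_exp).inv
  have hψ1 : ∀ x, ψ x ≤ 1 := fun x => by
    simp only [hψ]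
    exact ENNReal.inv_le_one.2 le_self_add
  have hψanti : ∀ x y, x ≤ y → ψ y ≤ ψ x := fun x y h => by
    simp only [hψ]
    exact ENNReal.inv_le_inv.2 (add_le_add_right (EReal.exp_monotone h) 1)
  have hψinj : ∀ x y, ψ x = ψ y → x = y := fun x y h => by
    simp only [hψ] at h
    have h1 := inv_injective h
    exact EReal.exp_strictMono.injective ((ENNReal.add_right_inj ENNReal.one_ne_top).1 h1)
  let U : Set (Ω → EReal) := {h | Measurable h ∧ ∀ i, f i ≤ᵐ[μ] h}
  let I : (Ω → EReal) → ℝ≥0∞ := fun h => ∫⁻ ω, ψ (h ω) ∂μ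
  have hne : (I '' U).Nonempty :=
    ⟨_, ⊤, ⟨measurable_const, fun i => ae_of_all _ fun _ => le_top⟩, rfl⟩
  obtain ⟨c, -, hc, hcU⟩ := exists_seq_tendsto_sSup hne (OrderTop.bddAbove _)
  choose k hkU hkc using hcU
  let g : Ω → EReal := fun ω => ⨅ n, k n ω
  have hgm : Measurable g := Measurable.iInf fun n => (hkU n).1
  have hgU : ∀ i, f i ≤ᵐ[μ] g := fun i => by
    filter_upwards [ae_all_iff.2 fun n => (hkU n).2 i] with ω hω
    exact le_iInf hω
  have hIg : sSup (I '' U) ≤ I g := by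
    refine le_of_tendsto' hc fun n => ?_
    rw [← hkc n]
    exact lintegral_mono fun ω => hψanti _ _ (iInf_le _ n)
  refine ⟨g, hgm, hgU, fun h hm hh => ?_⟩
  have hmin : (fun ω => min (g ω) (h ω)) ∈ U :=
    ⟨hgm.min hm, fun i => by
      filter_upwards [hgU i, hh i] with ω h1 h2 using le_min h1 h2⟩
  have hle : I (fun ω => min (g ω) (h ω)) ≤ I g :=
    (le_sSup (Set.mem_image_of_mem I hmin)).trans hIg
  have hfin : I g ≠ ∞ := by
    refine ne_top_of_le_ne_top (measure_ne_top μ Set.univ) ?_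
    calc I g ≤ ∫⁻ _, 1 ∂μ := lintegral_mono fun ω => hψ1 _
      _ = μ Set.univ := by simp
  have hae := ae_eq_of_ae_le_of_lintegral_le
    (ae_of_all μ fun ω => hψanti _ _ (min_le_left (g ω) (h ω))) hfin
    (hψm.comp (hgm.min hm)).aemeasurable hle
  filter_upwards [hae] with ω hω
  rw [hψinj _ _ hω]
  exact min_le_right _ _

/-- The essential supremum of a family of functions, unique up to `μ`-null sets. -/
noncomputable def essSupFamily {m : MeasurableSpace Ω} (μ : Measure Ω) [IsFiniteMeasure μ]
    (f : ι → Ω → EReal) : Ω → EReal :=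
  (exists_isEssSup μ f).choose

theorem isEssSup_essSupFamily {m : MeasurableSpace Ω} (μ : Measure Ω) [IsFiniteMeasure μ]
    (f : ι → Ω → EReal) : IsEssSup μ f (essSupFamily μ f) :=
  (exists_isEssSup μ f).choose_spec

/-- The essential infimum of a family of functions. -/
noncomputable def essInfFamily {m : MeasurableSpace Ω} (μ : Measure Ω) [IsFiniteMeasure μ]
    (f : ι → Ω → EReal) : Ω → EReal :=
  fun ω => - essSupFamily μ (fun i ω' => - f i ω') ω

end EssSup

/-- The conditional expectation `E_Q[Y | m]` of an extended real random variable `Y` on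
`(Ω, m₀, Q)`, as the difference `E_Q[Y⁺ | m] - E_Q[Y⁻ | m]` of two conditional expectations of
`[0, ∞]`-valued variables. Where both are infinite, the value is `-∞`. -/
noncomputable def extCondExp {Ω : Type*} (m : MeasurableSpace Ω) {m₀ : MeasurableSpace Ω}
    (Q : Measure Ω) (Y : Ω → EReal) : Ω → EReal :=
  fun ω => (condLExp m Q (fun ω' => (Y ω').toENNReal) ω : EReal)
    - (condLExp m Q (fun ω' => (- Y ω').toENNReal) ω : EReal)

variable {Ω : Type*} {m : MeasurableSpace Ω} {T : ℝ}

/-- The space `L^p(𝓕_t)`, that is `L^p(Ω, 𝓕_t, P|_{𝓕_t})`. -/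
abbrev LpAt (P : Measure Ω) (𝓕 : Filtration (Set.Icc (0 : ℝ) T) m) (p : ℝ≥0∞)
    (t : Set.Icc (0 : ℝ) T) : Type _ :=
  Lp ℝ p (P.trim (𝓕.le t))

/-- The inclusion `L^p(𝓕_s) ⊆ L^p(𝓕_t)` for `s ≤ t`. -/
noncomputable def incl {P : Measure Ω} {𝓕 : Filtration (Set.Icc (0 : ℝ) T) m} {p : ℝ≥0∞}
    {s t : Set.Icc (0 : ℝ) T} (h : s ≤ t) (X : LpAt P 𝓕 p s) : LpAt P 𝓕 p t :=
  (memLp_of_memLp_trim (𝓕.mono h)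
    (by rw [trim_trim]; exact Lp.memLp X : MemLp X p ((P.trim (𝓕.le t)).trim (𝓕.mono h)))).toLp X

/-- A fully-dynamic risk measure `(ρ_{st})_{0 ≤ s ≤ t ≤ T}`, `ρ_{st} : L^p(𝓕_t) → L^p(𝓕_s)`. -/
structure RiskMeasure (P : Measure Ω) (𝓕 : Filtration (Set.Icc (0 : ℝ) T) m) (p : ℝ≥0∞) where
  /-- `ρ_{st}`, for `s ≤ t` -/
  toFun : ∀ {s t : Set.Icc (0 : ℝ) T}, s ≤ t → LpAt P 𝓕 p t → LpAt P 𝓕 p s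
  monotone : ∀ {s t : Set.Icc (0 : ℝ) T} (h : s ≤ t) (X Y : LpAt P 𝓕 p t),
    X ≥ Y → toFun h X ≤ toFun h Y
  convex : ∀ {s t : Set.Icc (0 : ℝ) T} (h : s ≤ t) (X Y : LpAt P 𝓕 p t) (l : ℝ),
    0 ≤ l → l ≤ 1 →
      toFun h (l • X + (1 - l) • Y) ≤ l • toFun h X + (1 - l) • toFun h Y
  translation_invariant : ∀ {s t : Set.Icc (0 : ℝ) T} (h : s ≤ t) (X : LpAt P 𝓕 p t)
    (Y : LpAt P 𝓕 p s), toFun h (X + incl h Y) = toFun h X - Y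
  continuous_from_below : p = ∞ → ∀ {s t : Set.Icc (0 : ℝ) T} (h : s ≤ t)
    (X : ℕ → LpAt P 𝓕 p t) (X' : LpAt P 𝓕 p t), Monotone X →
      (∀ᵐ ω ∂(P.trim (𝓕.le t)), Tendsto (fun n => X n ω) atTop (𝓝 (X' ω))) →
      ∀ᵐ ω ∂(P.trim (𝓕.le s)), Tendsto (fun n => toFun h (X n) ω) atTop (𝓝 (toFun h X' ω))

/-- The set `𝒬_{st}` of the measures `Q` on `𝓕_t` with `Q ≪ P` on `𝓕_t` and `Q = P` on `𝓕_s`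
(in particular `Q` is a probability measure). -/
def scenarios (P : Measure Ω) (𝓕 : Filtration (Set.Icc (0 : ℝ) T) m)
    {s t : Set.Icc (0 : ℝ) T} (h : s ≤ t) : Set (@Measure Ω (𝓕 t)) :=
  {Q | Q ≪ P.trim (𝓕.le t) ∧ Q.trim (𝓕.mono h) = P.trim (𝓕.le s)}

/-- The pasting `S = Q|_{𝓕_t} · R` of a measure `Q` on `𝓕_u` and a measure `R` on `𝓕_u`: the
measure on `𝓕_u` with density `dS/dP = dQ|_{𝓕_t}/dP · dR/dP`. -/
noncomputable def pasting (P : Measure Ω) (𝓕 : Filtration (Set.Icc (0 : ℝ) T) m)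
    {t u : Set.Icc (0 : ℝ) T} (h : t ≤ u) (Q R : @Measure Ω (𝓕 u)) : @Measure Ω (𝓕 u) :=
  (P.trim (𝓕.le u)).withDensity fun ω =>
    (Q.trim (𝓕.mono h)).rnDeriv (P.trim (𝓕.le t)) ω * R.rnDeriv (P.trim (𝓕.le u)) ω

namespace RiskMeasure

variable {P : Measure Ω} {𝓕 : Filtration (Set.Icc (0 : ℝ) T) m} {p : ℝ≥0∞}

/-- Weak time-consistency: `ρ_{su}(ρ_{tu}(0) - ρ_{tu}(X)) = ρ_{su}(X)`. -/
def WeaklyTimeConsistent (ρ : RiskMeasure P 𝓕 p) : Prop :=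
  ∀ ⦃s t u : Set.Icc (0 : ℝ) T⦄ (hst : s ≤ t) (htu : t ≤ u) (X : LpAt P 𝓕 p u),
    ρ.toFun (hst.trans htu) (incl htu (ρ.toFun htu 0 - ρ.toFun htu X))
      = ρ.toFun (hst.trans htu) X

/-- The minimal penalty
`α_{st}(Q) = ess.sup_{X ∈ L^p(𝓕_t)} { E_Q[-X | 𝓕_s] - ρ_{st}(X) }`. -/
noncomputable def penalty [IsFiniteMeasure P] (ρ : RiskMeasure P 𝓕 p)
    {s t : Set.Icc (0 : ℝ) T} (h : s ≤ t) (Q : @Measure Ω (𝓕 t)) : Ω → EReal :=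
  essSupFamily (P.trim (𝓕.le s)) fun (X : LpAt P 𝓕 p t) ω =>
    extCondExp (𝓕 s) Q (fun ω' => ((-X ω' : ℝ) : EReal)) ω - ((ρ.toFun h X ω : ℝ) : EReal)

/-- The normalisation term `ess.inf_{R ∈ 𝒬_{tu}} α_{tu}(R)`. -/
noncomputable def minPenalty [IsFiniteMeasure P] (ρ : RiskMeasure P 𝓕 p)
    {t u : Set.Icc (0 : ℝ) T} (h : t ≤ u) : Ω → EReal :=
  essInfFamily (P.trim (𝓕.le t)) fun R : scenarios P 𝓕 h => ρ.penalty h R.1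

/-- `Q ∈ 𝒬_{st}` is an optimal scenario for `X` in the dual representation
`ρ_{st}(X) = ess.max_{Q ∈ 𝒬_{st}} { E_Q[-X | 𝓕_s] - α_{st}(Q) }`: it attains the value
`ρ_{st}(X)`. -/
def IsOptimalScenario [IsFiniteMeasure P] (ρ : RiskMeasure P 𝓕 p)
    {s t : Set.Icc (0 : ℝ) T} (h : s ≤ t) (X : LpAt P 𝓕 p t) (Q : @Measure Ω (𝓕 t)) : Prop :=
  Q ∈ scenarios P 𝓕 h ∧
    ∀ᵐ ω ∂(P.trim (𝓕.le s)), ((ρ.toFun h X ω : ℝ) : EReal) =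
      extCondExp (𝓕 s) Q (fun ω' => ((-X ω' : ℝ) : EReal)) ω - ρ.penalty h Q ω

/-- `E_P[α_{st}(Q)] < ∞`. (For `Q ∈ 𝒬_{st}` the negative part of `α_{st}(Q)` is always integrable,
since `α_{st}(Q) ≥ -ρ_{st}(0)`.) -/
def HasFiniteMeanPenalty [IsFiniteMeasure P] (ρ : RiskMeasure P 𝓕 p)
    {s t : Set.Icc (0 : ℝ) T} (h : s ≤ t) (Q : @Measure Ω (𝓕 t)) : Prop :=
  ∫⁻ ω, (ρ.penalty h Q ω).toENNReal ∂(P.trim (𝓕.le s)) < ∞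

/-- The right-hand side
`α_{su}(Q) + E_Q[α_{tu}(R) - ess.inf_{R' ∈ 𝒬_{tu}} α_{tu}(R') | 𝓕_s]`. -/
noncomputable def cocycleRHS [IsFiniteMeasure P] (ρ : RiskMeasure P 𝓕 p)
    {s t u : Set.Icc (0 : ℝ) T} (hst : s ≤ t) (htu : t ≤ u) (Q R : @Measure Ω (𝓕 u)) :
    Ω → EReal :=
  fun ω => ρ.penalty (hst.trans htu) Q ω +
    extCondExp (𝓕 s) Q (fun ω' => ρ.penalty htu R ω' - ρ.minPenalty htu ω') ω

end RiskMeasure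

end FullyDynamic

namespace FullyDynamic

/-! ### Subgradients and positive functionals -/

/-! For X in L^p(F_u) put D = ρ_tu(0) - ρ_tu(X); weak time-consistency says ρ_su(D) = ρ_su(X).
Everything rests on the attained dual representation together with one inequality relating X under S
to D under Q.

Attainment (`exists_optimalScenario`). The map X ↦ ∫ ρ_st(X) dP is a real convex function on L^p and
so has an algebraic subgradient. Its negative is positive by monotonicity of ρ, and agrees with P on
F_s by translation invariance. A positive functional on L^p is an integral against a measure: for p
< ∞ by automatic continuity, for p = ∞ by continuity from below. Locality of ρ turns the integrated
subgradient inequality into an almost sure one, which says that X attains the supremum defining the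
penalty of that measure. Applied to the position 0, this gives ess inf α_tu = -ρ_tu(0).

The inequality. The definition of α_tu(R) gives E_R[-X | F_t] ≤ -D + (α_tu(R) + ρ_tu(0)), with
equality when R is optimal for X. The bracket is nonnegative; it is the excess of α_tu(R) over the
minimal penalty. Applying E_Q[· | F_s] and the tower property for S gives E_S[-X | F_s] ≤ E_Q[-D |
F_s] + E_Q[excess | F_s].

(b) Subtract ρ_su(X) = ρ_su(D), bound E_Q[-D | F_s] - ρ_su(D) by α_su(Q), and take the supremum over
X. At optimal Q and R both estimates are equalities.

(a) With optimal R for X and optimal Q for D, the cocycle identity gives ρ_su(D) = E_S[-X | F_s] -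
α_su(S) ≤ ρ_su(X). Conversely, write an optimal Q for X as its own pasting with some R. The cocycle
identity then forces E_Q[excess | F_s] = 0, hence ρ_su(X) ≤ E_Q[-D | F_s] - α_su(Q) ≤ ρ_su(D).

Infinite values are the technical burden: the inequality is kept in [0,∞] with positive and negative
parts moved to opposite sides, and subtraction happens only pointwise at the end. -/

theorem exists_subgradient {E : Type*} [AddCommGroup E] [Module ℝ E] {f : E → ℝ}
    (hf : ConvexOn ℝ Set.univ f) (x : E) : ∃ φ : E →ₗ[ℝ] ℝ, ∀ v, f x + φ v ≤ f (x + v) := by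
  -- `N` is the one-sided directional derivative of `f` at `x`, an infimum of difference quotients.
  -- It is sublinear, and any linear functional below it is a subgradient.
  let q : E → Set.Ioi (0 : ℝ) → ℝ := fun v t => (f (x + (t : ℝ) • v) - f x) / t
  let N : E → ℝ := fun v => ⨅ t, q v t
  have : Nonempty (Set.Ioi (0 : ℝ)) := ⟨⟨1, by simp⟩⟩
  -- The infimum is finite because `x` is a convex combination of `x + t • v` and `x - v`.
  have hq : ∀ v t, f x - f (x - v) ≤ q v t := by
    rintro v ⟨t, ht⟩
    have ht : 0 < t := ht
    have h := hf.2 (Set.mem_univ (x + t • v)) (Set.mem_univ (x - v))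
      (show 0 ≤ 1 / (1 + t) by positivity) (show 0 ≤ t / (1 + t) by positivity) (by field_simp)
    have hx : (1 / (1 + t)) • (x + t • v) + (t / (1 + t)) • (x - v) = x := by
      have h1 : (1 / (1 + t)) • (x + t • v) + (t / (1 + t)) • (x - v)
        = (1 / (1 + t) + t / (1 + t)) • x + (1 / (1 + t) * t - t / (1 + t)) • v := by module
      rw [h1, show 1 / (1 + t) + t / (1 + t) = 1 by field_simp,
        show 1 / (1 + t) * t - t / (1 + t) = 0 by field_simp; ring]
      simp
    rw [hx] at h
    simp only [smul_eq_mul] at h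
    field_simp at h
    simp only [q]
    rw [le_div_iff₀ ht]
    linarith
  have hbdd : ∀ v, BddBelow (Set.range (q v)) := fun v =>
    ⟨_, Set.forall_mem_range.2 fun t => hq v t⟩
  have hNle : ∀ v t, N v ≤ q v t := fun v t => ciInf_le (hbdd v) t
  have hhom : ∀ c : ℝ, 0 < c → ∀ v, N (c • v) ≤ c * N v := by
    intro c hc v
    rw [← div_le_iff₀' hc]
    refine le_ciInf fun t => ?_
    rw [div_le_iff₀' hc]
    refine (hNle _ ⟨t / c, div_pos t.2 hc⟩).trans_eq ?_
    have : (t : ℝ) ≠ 0 := t.2.ne'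
    simp only [q, smul_smul, div_mul_cancel₀ _ hc.ne']
    field_simp
  have hhom' : ∀ c : ℝ, 0 < c → ∀ v, N (c • v) = c * N v := by
    intro c hc v
    refine le_antisymm (hhom c hc v) ?_
    have h := hhom c⁻¹ (inv_pos.2 hc) (c • v)
    rw [smul_smul, inv_mul_cancel₀ hc.ne', one_smul] at h
    calc c * N v ≤ c * (c⁻¹ * N (c • v)) := by gcongr
      _ = N (c • v) := by field_simp
  have hadd : ∀ u v, N (u + v) ≤ N u + N v := by
    intro u v
    rw [← sub_le_iff_le_add]
    refine le_ciInf fun s => ?_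
    rw [sub_le_comm]
    refine le_ciInf fun t => ?_
    rw [sub_le_iff_le_add]
    obtain ⟨s, hs⟩ := s
    obtain ⟨t, ht⟩ := t
    have hs : 0 < s := hs
    have ht : 0 < t := ht
    -- This step length makes `x + step • (u + v)` a convex combination of `x + s • u` and `x + t •
    -- v`.
    refine (hNle _ ⟨s * t / (s + t), by simp only [Set.mem_Ioi]; positivity⟩).trans ?_
    have h := hf.2 (Set.mem_univ (x + s • u)) (Set.mem_univ (x + t • v))
      (show 0 ≤ t / (s + t) by positivity) (show 0 ≤ s / (s + t) by positivity)
      (by field_simp; ring)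
    have hx : (t / (s + t)) • (x + s • u) + (s / (s + t)) • (x + t • v)
        = x + (s * t / (s + t)) • (u + v) := by
      have h1 : (t / (s + t)) • (x + s • u) + (s / (s + t)) • (x + t • v)
        = (t / (s + t) + s / (s + t)) • x + (s * t / (s + t)) • (u + v) := by module
      rw [h1, show t / (s + t) + s / (s + t) = 1 by field_simp; ring, one_smul]
    rw [hx] at h
    simp only [smul_eq_mul] at h
    simp only [q]
    rw [div_le_iff₀ (by positivity), sub_le_iff_le_add]
    refine h.trans_eq ?_
    field_simp
    ring
  have hN0 : N 0 = 0 := by simp [N, q]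
  -- Hahn–Banach, extending the zero functional from the trivial subspace.
  obtain ⟨φ, -, hφ⟩ := exists_extension_of_le_sublinear (⟨⊥, 0⟩ : E →ₗ.[ℝ] ℝ) N hhom' hadd (by
    rintro ⟨v, hv⟩
    obtain rfl : v = 0 := hv
    exact hN0.ge)
  refine ⟨φ, fun v => ?_⟩
  have h := (hφ v).trans (hNle v ⟨1, by simp⟩)
  simp only [q, one_smul, div_one] at h
  linarith

/-- An unbounded positive functional is unbounded on the positive cone already. A norm-convergent
series of positive vectors can then be chosen with each term sent to at least `2 ^ n`; its sum
dominates every term, so its image would exceed every `2 ^ n`. -/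
theorem continuous_of_nonneg {E : Type*} [NormedAddCommGroup E] [Lattice E]
    [IsOrderedAddMonoid E] [HasSolidNorm E] [NormedSpace ℝ E] [PosSMulMono ℝ E]
    [CompleteSpace E] (ψ : E →ₗ[ℝ] ℝ) (hψ : ∀ x, 0 ≤ x → 0 ≤ ψ x) : Continuous ψ := by
  have hmono : ∀ x y, x ≤ y → ψ x ≤ ψ y := fun x y h => by
    have := hψ (y - x) (sub_nonneg.2 h)
    rw [map_sub] at this
    linarith
  by_contra hcont
  have hub : ∀ C : ℝ, 0 < C → ∃ y : E, 0 ≤ y ∧ C * ‖y‖ < ψ y := by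
    intro C hC
    by_contra! hC'
    refine hcont (ψ.mkContinuous C fun x => ?_).continuous
    have h1 := hC' |x| (abs_nonneg x)
    rw [norm_abs_eq_norm] at h1
    have h2 := hmono x |x| (le_abs_self x)
    have h3 := hmono (-x) |x| (neg_le_abs x)
    rw [map_neg] at h3
    rw [Real.norm_eq_abs]
    exact abs_le'.2 ⟨h2.trans h1, h3.trans h1⟩
  -- Growth `4 ^ n` against the normalisation `2 ^ n * ‖y n‖` leaves `2 ^ n`, while the norms remain
  -- summable.
  choose y hy0 hy using fun n : ℕ => hub ((4 : ℝ) ^ n) (by positivity)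
  have hyn : ∀ n, 0 < ‖y n‖ := by
    intro n
    rcases (norm_nonneg (y n)).eq_or_lt with h | h
    · have h1 := hy n
      rw [norm_eq_zero.1 h.symm] at h1
      simp at h1
    · exact h
  let z : ℕ → E := fun n => ((2 ^ n * ‖y n‖)⁻¹ : ℝ) • y n
  have hz0 : ∀ n, 0 ≤ z n := fun n => smul_nonneg (inv_nonneg.2 (by positivity)) (hy0 n)
  have hzn : ∀ n, ‖z n‖ = (1 / 2) ^ n := fun n => by
    have := (hyn n).ne'
    simp only [z, norm_smul, norm_inv, norm_mul, norm_pow, norm_norm, Real.norm_ofNat]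
    field_simp
    simp
  have hsum : Summable z := Summable.of_norm (by
    simp_rw [hzn]; exact summable_geometric_two)
  have hle : ∀ n, (2 : ℝ) ^ n ≤ ψ (∑' n, z n) := fun n => by
    refine le_trans ?_ (hmono _ _ (hsum.le_tsum n fun j _ => hz0 j))
    simp only [z, map_smul, smul_eq_mul]
    have h2 : (0 : ℝ) < 2 ^ n * ‖y n‖ := mul_pos (by positivity) (hyn n)
    rw [inv_mul_eq_div, le_div_iff₀ h2]
    refine le_trans (le_of_eq ?_) (hy n).le
    rw [← mul_assoc, ← mul_pow]
    norm_num
  obtain ⟨n, hn⟩ := pow_unbounded_of_one_lt (ψ (∑' n, z n)) (one_lt_two (α := ℝ))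
  exact absurd (hle n) (not_le.2 hn)

/-! ### Extended real arithmetic -/

section Arithmetic

open scoped NNReal

variable {a b a' b' x y : ℝ≥0∞} {α γ : EReal} {c k : ℝ}

theorem coe_nnreal_coe_ennreal (x : ℝ≥0) : (((x : ℝ≥0) : ℝ≥0∞) : EReal) = ((x : ℝ) : EReal) :=
  rfl

/-- Since `⊤ - ⊤ = ⊥` in `EReal`, a real value of the difference excludes every infinite entry. -/
theorem ne_top_of_coe_eq_sub_sub (h : (c : EReal) = (a : EReal) - (b : EReal) - α) :
    a ≠ ∞ ∧ b ≠ ∞ ∧ α ≠ ⊤ ∧ α ≠ ⊥ := by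
  have hα : α ≠ ⊤ := by
    rintro rfl
    simp at h
  have hb : b ≠ ∞ := by
    rintro rfl
    simp at h
  have ha : a ≠ ∞ := by
    rintro rfl
    lift b to ℝ≥0 using hb
    rw [EReal.coe_ennreal_top, coe_nnreal_coe_ennreal, EReal.top_sub_coe, EReal.top_sub hα] at h
    exact EReal.coe_ne_top _ h
  refine ⟨ha, hb, hα, ?_⟩
  rintro rfl
  lift a to ℝ≥0 using ha
  lift b to ℝ≥0 using hb
  rw [coe_nnreal_coe_ennreal, coe_nnreal_coe_ennreal, ← EReal.coe_sub, EReal.coe_sub_bot] at h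
  exact EReal.coe_ne_top _ h

/-- Used with `a`, `b` the conditional expectations of the negative and positive parts of X under R,
`r` = ρ_tu(X), `r₀` = ρ_tu(0) and `α` = α_tu(R). The conclusion contains only sums in [0,∞], so a
conditional expectation can be applied to it without integrability. -/
theorem add_ofReal_le_of_sub_le {r r₀ : ℝ} (h : (a : EReal) - (b : EReal) - (r : EReal) ≤ α) :
    a + ENNReal.ofReal (r₀ - r)
      ≤ b + (α - ((-r₀ : ℝ) : EReal)).toENNReal + ENNReal.ofReal (-(r₀ - r)) := by
  by_cases hb : b = ∞
  · simp [hb]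
  by_cases hα : α = ⊤
  · rw [hα, EReal.top_sub_coe, EReal.toENNReal_top]
    simp
  lift b to ℝ≥0 using hb
  by_cases ha : a = ∞
  · rw [ha, EReal.coe_ennreal_top, coe_nnreal_coe_ennreal, EReal.top_sub_coe, EReal.top_sub_coe,
      top_le_iff] at h
    exact absurd h hα
  lift a to ℝ≥0 using ha
  rw [coe_nnreal_coe_ennreal, coe_nnreal_coe_ennreal, ← EReal.coe_sub, ← EReal.coe_sub] at h
  induction α with
  | bot => exact absurd (le_bot_iff.1 h) (EReal.coe_ne_bot _)
  | top => exact absurd rfl hα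
  | coe α =>
    rw [EReal.coe_le_coe_iff] at h
    rw [← EReal.coe_sub, EReal.real_coe_toENNReal]
    simp only [ENNReal.ofReal]
    norm_cast
    rw [← NNReal.coe_le_coe]
    push_cast [Real.coe_toNNReal']
    grind

theorem add_ofReal_eq_of_eq_sub {r r₀ : ℝ} (h : (r : EReal) = (a : EReal) - (b : EReal) - α)
    (hα : ((-r₀ : ℝ) : EReal) ≤ α) :
    a + ENNReal.ofReal (r₀ - r)
      = b + (α - ((-r₀ : ℝ) : EReal)).toENNReal + ENNReal.ofReal (-(r₀ - r)) := by
  obtain ⟨ha, hb, hα1, hα2⟩ := ne_top_of_coe_eq_sub_sub h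
  lift b to ℝ≥0 using hb
  lift a to ℝ≥0 using ha
  lift α to ℝ using ⟨hα1, hα2⟩
  rw [coe_nnreal_coe_ennreal, coe_nnreal_coe_ennreal, ← EReal.coe_sub, ← EReal.coe_sub,
    EReal.coe_eq_coe_iff] at h
  rw [EReal.coe_le_coe_iff] at hα
  rw [← EReal.coe_sub, EReal.real_coe_toENNReal]
  simp only [ENNReal.ofReal]
  norm_cast
  rw [← NNReal.coe_inj]
  push_cast [Real.coe_toNNReal']
  grind

theorem add_le_ofReal_of_two_mul_sub_le {r q : ℝ}
    (h : (r : EReal) = (a : EReal) - (b : EReal) - α)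
    (h2 : ((a + a : ℝ≥0∞) : EReal) - (q : EReal) ≤ α) : a + b ≤ ENNReal.ofReal (q - r) := by
  obtain ⟨ha, hb, hα1, hα2⟩ := ne_top_of_coe_eq_sub_sub h
  lift b to ℝ≥0 using hb
  lift a to ℝ≥0 using ha
  lift α to ℝ using ⟨hα1, hα2⟩
  rw [coe_nnreal_coe_ennreal, coe_nnreal_coe_ennreal, ← EReal.coe_sub, ← EReal.coe_sub,
    EReal.coe_eq_coe_iff] at h
  rw [EReal.coe_ennreal_add, coe_nnreal_coe_ennreal, ← EReal.coe_add, ← EReal.coe_sub,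
    EReal.coe_le_coe_iff] at h2
  simp only [ENNReal.ofReal]
  norm_cast
  rw [← NNReal.coe_le_coe]
  push_cast [Real.coe_toNNReal']
  grind

/-- Here and in the next three lemmas the sum in `h` is the paste inequality or equality: `a`, `b`
belong to X under the pasted measure, `x`, `a'` are the positive and negative parts of D under Q,
and `y` is the expected excess penalty. Each lemma returns to subtraction, after infinite entries
are excluded or shown harmless. -/
theorem sub_sub_le_add (h : a + x ≤ b + y + a') (hα : (k : EReal) ≤ α)
    (hx : α ≠ ⊤ → x ≠ ∞ ∧ a' ≠ ∞) (hc : (a' : EReal) - (x : EReal) - (c : EReal) ≤ α) :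
    (a : EReal) - (b : EReal) - (c : EReal) ≤ α + (y : EReal) := by
  have hα0 : α ≠ ⊥ := ne_bot_of_le_ne_bot (EReal.coe_ne_bot k) hα
  by_cases hα1 : α = ⊤
  · rw [hα1, EReal.top_add_of_ne_bot (EReal.coe_ennreal_ne_bot _)]
    exact le_top
  by_cases hy : y = ∞
  · rw [hy, EReal.coe_ennreal_top, EReal.add_top_of_ne_bot hα0]
    exact le_top
  by_cases hb : b = ∞
  · simp [hb]
  obtain ⟨hx', ha'⟩ := hx hα1
  have ha : a ≠ ∞ := by
    rintro rfl
    rw [top_add, top_le_iff] at h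
    exact ENNReal.add_ne_top.2 ⟨ENNReal.add_ne_top.2 ⟨hb, hy⟩, ha'⟩ h
  lift b to ℝ≥0 using hb
  lift a to ℝ≥0 using ha
  lift a' to ℝ≥0 using ha'
  lift x to ℝ≥0 using hx'
  lift y to ℝ≥0 using hy
  lift α to ℝ using ⟨hα1, hα0⟩
  norm_cast at h
  rw [← NNReal.coe_le_coe] at h
  push_cast at h
  simp only [coe_nnreal_coe_ennreal, ← EReal.coe_sub, ← EReal.coe_add, EReal.coe_le_coe_iff]
    at hc ⊢
  linarith

theorem add_le_of_sub_sub_le (h : a + x = b + y + a')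
    (hc : (c : EReal) = (a' : EReal) - (x : EReal) - α)
    (hγ : (a : EReal) - (b : EReal) - (c : EReal) ≤ γ) (hb : b = ∞ → γ = ⊤) :
    α + (y : EReal) ≤ γ := by
  by_cases hγ1 : γ = ⊤
  · rw [hγ1]
    exact le_top
  have hb : b ≠ ∞ := fun h => hγ1 (hb h)
  obtain ⟨ha', hx, hα1, hα0⟩ := ne_top_of_coe_eq_sub_sub hc
  lift b to ℝ≥0 using hb
  have ha : a ≠ ∞ := by
    rintro rfl
    rw [EReal.coe_ennreal_top, coe_nnreal_coe_ennreal, EReal.top_sub_coe, EReal.top_sub_coe,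
      top_le_iff] at hγ
    exact hγ1 hγ
  have hy : y ≠ ∞ := by
    rintro rfl
    rw [add_top, top_add] at h
    exact ENNReal.add_ne_top.2 ⟨ha, hx⟩ h
  lift a to ℝ≥0 using ha
  lift a' to ℝ≥0 using ha'
  lift x to ℝ≥0 using hx
  lift y to ℝ≥0 using hy
  lift α to ℝ using ⟨hα1, hα0⟩
  refine le_trans (le_of_eq ?_) hγ
  norm_cast at h
  rw [← NNReal.coe_inj] at h
  push_cast at h
  simp only [coe_nnreal_coe_ennreal, ← EReal.coe_sub, ← EReal.coe_add, EReal.coe_eq_coe_iff]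
    at hc ⊢
  linarith

theorem le_of_coe_eq_sub_sub {c' : ℝ} (h : a + x = b + y + a') (ha : a ≠ ∞) (hb : b ≠ ∞)
    (hc : (c : EReal) = (a' : EReal) - (x : EReal) - α)
    (hγ : (a : EReal) - (b : EReal) - (c' : EReal) ≤ α + (y : EReal)) : c ≤ c' := by
  obtain ⟨ha', hx, hα1, hα0⟩ := ne_top_of_coe_eq_sub_sub hc
  have hy : y ≠ ∞ := by
    rintro rfl
    rw [add_top, top_add] at h
    exact ENNReal.add_ne_top.2 ⟨ha, hx⟩ h
  lift b to ℝ≥0 using hb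
  lift a to ℝ≥0 using ha
  lift a' to ℝ≥0 using ha'
  lift x to ℝ≥0 using hx
  lift y to ℝ≥0 using hy
  lift α to ℝ using ⟨hα1, hα0⟩
  norm_cast at h
  rw [← NNReal.coe_inj] at h
  push_cast at h
  simp only [coe_nnreal_coe_ennreal, ← EReal.coe_sub, ← EReal.coe_add, EReal.coe_eq_coe_iff,
    EReal.coe_le_coe_iff] at hc hγ
  linarith

theorem le_of_coe_eq_sub_sub_self {c' : ℝ} (h : a + x ≤ b + y + a')
    (hc : (c : EReal) = (a : EReal) - (b : EReal) - α) (hα : α = α + (y : EReal))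
    (hx : α ≠ ⊤ → x ≠ ∞ ∧ a' ≠ ∞) (hγ : (a' : EReal) - (x : EReal) - (c' : EReal) ≤ α) :
    c ≤ c' := by
  obtain ⟨ha, hb, hα1, hα0⟩ := ne_top_of_coe_eq_sub_sub hc
  obtain ⟨hx', ha'⟩ := hx hα1
  have hy : y ≠ ∞ := by
    rintro rfl
    rw [EReal.coe_ennreal_top, EReal.add_top_of_ne_bot hα0] at hα
    exact hα1 hα
  lift b to ℝ≥0 using hb
  lift a to ℝ≥0 using ha
  lift a' to ℝ≥0 using ha'
  lift x to ℝ≥0 using hx'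
  lift y to ℝ≥0 using hy
  lift α to ℝ using ⟨hα1, hα0⟩
  norm_cast at h
  rw [← NNReal.coe_le_coe] at h
  push_cast at h
  simp only [coe_nnreal_coe_ennreal, ← EReal.coe_sub, ← EReal.coe_add, EReal.coe_eq_coe_iff,
    EReal.coe_le_coe_iff] at hc hγ hα
  linarith

end Arithmetic

/-! ### Representation of positive functionals on `L^p` by measures -/

theorem ae_abs_le_norm {Ω : Type*} {m : MeasurableSpace Ω} {μ : Measure Ω} (X : Lp ℝ ∞ μ) :
    ∀ᵐ ω ∂μ, |X ω| ≤ ‖X‖ := by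
  filter_upwards [enorm_ae_le_eLpNormEssSup X μ] with ω h
  rw [← Real.norm_eq_abs, Lp.norm_def, ← toReal_enorm, eLpNorm_exponent_top]
  refine ENNReal.toReal_mono ?_ h
  rw [← eLpNorm_exponent_top]
  exact Lp.eLpNorm_ne_top X

section Representation

variable {Ω : Type*} {m : MeasurableSpace Ω} {μ : Measure Ω} [IsFiniteMeasure μ] {p : ℝ≥0∞}

instance : PosSMulMono ℝ (Lp ℝ p μ) := by
  refine PosSMulMono.of_smul_nonneg fun c hc X hX => ?_
  rw [← Lp.coeFn_le] at hX ⊢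
  filter_upwards [hX, Lp.coeFn_smul c X, Lp.coeFn_zero ℝ p μ] with ω h1 h2 h3
  rw [h3, Pi.zero_apply] at h1 ⊢
  rw [h2, Pi.smul_apply, smul_eq_mul]
  exact mul_nonneg hc h1

/-- The indicator function of a measurable set, as an element of `L^p`. -/
noncomputable abbrev indLp (μ : Measure Ω) [IsFiniteMeasure μ] (p : ℝ≥0∞) {A : Set Ω}
    (hA : MeasurableSet A) : Lp ℝ p μ :=
  indicatorConstLp p hA (measure_ne_top μ A) (1 : ℝ)

theorem indLp_nonneg {A : Set Ω} (hA : MeasurableSet A) : 0 ≤ indLp μ p hA := by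
  rw [← Lp.coeFn_le]
  filter_upwards [indicatorConstLp_coeFn (p := p) (hs := hA) (hμs := measure_ne_top μ A)
    (c := (1 : ℝ)), Lp.coeFn_zero ℝ p μ] with ω h1 h2
  rw [h1, h2]
  exact Set.indicator_nonneg (fun _ _ => zero_le_one) ω

theorem indLp_union {A B : Set Ω} (hA : MeasurableSet A) (hB : MeasurableSet B)
    (hAB : Disjoint A B) : indLp μ p (hA.union hB) = indLp μ p hA + indLp μ p hB :=
  indicatorConstLp_disjoint_union hA hB (measure_ne_top μ A) (measure_ne_top μ B) hAB 1

theorem indLp_biUnion {f : ℕ → Set Ω} (hf : ∀ i, MeasurableSet (f i))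
    (hd : Pairwise (Function.onFun Disjoint f)) (n : ℕ) :
    indLp μ p (MeasurableSet.biUnion (Set.to_countable (Set.Iio n)) fun i _ => hf i)
      = ∑ i ∈ Finset.range n, indLp μ p (hf i) := by
  induction n with
  | zero =>
    rw [Finset.sum_range_zero]
    simp [indLp]
  | succ n ih =>
    rw [Finset.sum_range_succ, ← ih, ← indLp_union]
    · congr 1
      ext ω
      simp only [Set.mem_iUnion, Set.mem_Iio, Set.mem_union, exists_prop]
      constructor
      · rintro ⟨i, hi, h⟩
        rcases Nat.lt_succ_iff_lt_or_eq.1 hi with h' | rfl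
        · exact Or.inl ⟨i, h', h⟩
        · exact Or.inr h
      · rintro (⟨i, hi, h⟩ | h)
        · exact ⟨i, hi.trans n.lt_succ_self, h⟩
        · exact ⟨n, n.lt_succ_self, h⟩
    · simp only [Set.disjoint_iUnion_left, Set.mem_Iio]
      exact fun i hi => hd hi.ne

/-- Continuity along sequences exhausting the whole space suffices for countable additivity: adjoin
the complement of the full union to the partial unions, then cancel its value. -/
theorem exists_measure_eq_ofReal (ψ : Lp ℝ p μ →ₗ[ℝ] ℝ) (hψ : ∀ X, 0 ≤ X → 0 ≤ ψ X)
    (hcont : ∀ (A : ℕ → Set Ω) (hA : ∀ n, MeasurableSet (A n)), Monotone A →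
      ⋃ n, A n = Set.univ →
      Tendsto (fun n => ψ (indLp μ p (hA n))) atTop (𝓝 (ψ (indLp μ p MeasurableSet.univ)))) :
    ∃ Q : Measure Ω, ∀ (A : Set Ω) (hA : MeasurableSet A),
      Q A = ENNReal.ofReal (ψ (indLp μ p hA)) := by
  refine ⟨Measure.ofMeasurable (fun A hA => ENNReal.ofReal (ψ (indLp μ p hA))) ?_ ?_,
    fun A hA => Measure.ofMeasurable_apply A hA⟩
  · simp [indLp]
  intro f hf hd
  have hU : MeasurableSet (⋃ i, f i) := MeasurableSet.iUnion hf
  have hB : ∀ n, MeasurableSet (⋃ i ∈ Set.Iio n, f i) := fun n =>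
    MeasurableSet.biUnion (Set.to_countable (Set.Iio n)) fun i _ => hf i
  have hBU : ∀ n, (⋃ i ∈ Set.Iio n, f i) ⊆ ⋃ i, f i := fun n =>
    Set.iUnion₂_subset fun i _ => Set.subset_iUnion f i
  have h1 := hcont (fun n => (⋃ i ∈ Set.Iio n, f i) ∪ (⋃ i, f i)ᶜ)
    (fun n => (hB n).union hU.compl)
    (fun a b hab => Set.union_subset_union_left _
      (Set.biUnion_subset_biUnion_left (Set.Iio_subset_Iio hab))) (by
      rw [← Set.iUnion_union]
      refine Set.eq_univ_of_univ_subset ?_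
      rw [← Set.union_compl_self (⋃ i, f i)]
      refine Set.union_subset_union_left _ (Set.iUnion_subset fun i => ?_)
      refine Set.subset_iUnion_of_subset (i + 1) ?_
      exact Set.subset_iUnion₂_of_subset i (Nat.lt_succ_self i) subset_rfl)
  have h2 : indLp μ p MeasurableSet.univ = indLp μ p hU + indLp μ p hU.compl := by
    rw [← indLp_union hU hU.compl disjoint_compl_right]
    congr 1
    exact (Set.union_compl_self _).symm
  have h3 : ∀ n, indLp μ p ((hB n).union hU.compl)
      = ∑ i ∈ Finset.range n, indLp μ p (hf i) + indLp μ p hU.compl := fun n => by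
    rw [indLp_union (hB n) hU.compl (disjoint_compl_right.mono_left (hBU n)), ← indLp_biUnion hf hd]
  simp only [h2, h3, map_add, map_sum] at h1
  have h4 : Tendsto (fun n => ∑ i ∈ Finset.range n, ψ (indLp μ p (hf i))) atTop
      (𝓝 (ψ (indLp μ p hU))) := by
    simpa using h1.sub_const (ψ (indLp μ p hU.compl))
  have h5 := (hasSum_iff_tendsto_nat_of_nonneg (fun i => hψ _ (indLp_nonneg (hf i))) _).2 h4
  rw [← h5.tsum_eq]
  exact ENNReal.ofReal_tsum_of_nonneg (fun i => hψ _ (indLp_nonneg (hf i))) h5.summable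

/-- Positivity suffices for this inequality: compare `X` with each simple function below it.
Equality needs more and comes in the next lemma. -/
theorem lintegral_le_ofReal_of_nonneg {ψ : Lp ℝ p μ →ₗ[ℝ] ℝ} (hψ : ∀ X, 0 ≤ X → 0 ≤ ψ X)
    {Q : Measure Ω}
    (hQ : ∀ (A : Set Ω) (hA : MeasurableSet A), Q A = ENNReal.ofReal (ψ (indLp μ p hA)))
    (X : Lp ℝ p μ) (hX : 0 ≤ X) :
    ∫⁻ ω, ENNReal.ofReal (X ω) ∂Q ≤ ENNReal.ofReal (ψ X) := by
  rw [lintegral_eq_nnreal]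
  refine iSup₂_le fun g hg => ?_
  have hle : ∑ v ∈ g.range, (v : ℝ) • indLp μ p (g.measurableSet_fiber v) ≤ X := by
    rw [← Lp.coeFn_le]
    have h1 : ∀ᵐ ω ∂μ, ∀ v ∈ g.range, ((v : ℝ) • indLp μ p (g.measurableSet_fiber v)) ω
        = v * (g ⁻¹' {v}).indicator (fun _ => (1 : ℝ)) ω := by
      refine (Finset.eventually_all g.range).2 fun v _ => ?_
      filter_upwards [indicatorConstLp_coeFn (p := p) (hs := g.measurableSet_fiber v)
        (hμs := measure_ne_top μ _) (c := (1 : ℝ)),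
        Lp.coeFn_smul (v : ℝ) (indLp μ p (g.measurableSet_fiber v))] with ω h1 h2
      rw [h2, Pi.smul_apply, h1, smul_eq_mul]
    filter_upwards [h1, Lp.coeFn_le _ _ |>.2 hX, Lp.coeFn_zero ℝ p μ,
      Lp.coeFn_finsetSum g.range fun v => (v : ℝ) • indLp μ p (g.measurableSet_fiber v)]
      with ω h1 h2 h3 h4
    rw [h4, Finset.sum_apply, Finset.sum_congr rfl h1]
    have h5 : ∑ v ∈ g.range, (v : ℝ) * (g ⁻¹' {v}).indicator (fun _ => (1 : ℝ)) ω = g ω := by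
      rw [Finset.sum_eq_single (g ω)]
      · simp
      · intro v _ hv
        rw [Set.indicator_of_notMem, mul_zero]
        exact fun h => hv h.symm
      · exact fun h => absurd (g.mem_range_self ω) h
    rw [h5]
    have h6 := hg ω
    rw [h3] at h2
    rwa [ENNReal.ofReal, ENNReal.coe_le_coe, Real.le_toNNReal_iff_coe_le h2] at h6
  have hψle : ψ (∑ v ∈ g.range, (v : ℝ) • indLp μ p (g.measurableSet_fiber v)) ≤ ψ X := by
    have := hψ _ (sub_nonneg.2 hle)
    rw [map_sub] at this
    linarith
  refine le_trans (le_of_eq ?_) (ENNReal.ofReal_le_ofReal hψle)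
  rw [SimpleFunc.map_lintegral, map_sum, ENNReal.ofReal_sum_of_nonneg]
  · refine Finset.sum_congr rfl fun v _ => ?_
    rw [map_smul, smul_eq_mul, ENNReal.ofReal_mul v.coe_nonneg, hQ _ (g.measurableSet_fiber v)]
    simp
  · intro v _
    rw [map_smul, smul_eq_mul]
    exact mul_nonneg v.2 (hψ _ (indLp_nonneg _))

theorem exists_measure_integral_eq [Fact (1 ≤ p)] (ψ : Lp ℝ p μ →ₗ[ℝ] ℝ)
    (hψ : ∀ X, 0 ≤ X → 0 ≤ ψ X)
    (hcont : ∀ (A : ℕ → Set Ω) (hA : ∀ n, MeasurableSet (A n)), Monotone A →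
      ⋃ n, A n = Set.univ →
      Tendsto (fun n => ψ (indLp μ p (hA n))) atTop (𝓝 (ψ (indLp μ p MeasurableSet.univ)))) :
    ∃ Q : Measure Ω, IsFiniteMeasure Q ∧ Q ≪ μ ∧
      ∀ X : Lp ℝ p μ, Integrable X Q ∧ ∫ ω, X ω ∂Q = ψ X := by
  obtain ⟨Q, hQ⟩ := exists_measure_eq_ofReal ψ hψ hcont
  have hfin : IsFiniteMeasure Q := ⟨by
    rw [hQ _ MeasurableSet.univ]; exact ENNReal.ofReal_lt_top⟩
  have hac : Q ≪ μ := by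
    refine Measure.AbsolutelyContinuous.mk fun A hA h => ?_
    have h0 : indLp μ p hA = 0 := by
      ext1
      filter_upwards [indicatorConstLp_coeFn (p := p) (hs := hA) (hμs := measure_ne_top μ A)
        (c := (1 : ℝ)), Lp.coeFn_zero ℝ p μ, measure_eq_zero_iff_ae_notMem.1 h] with ω h1 h2 h3
      rw [h1, h2, Set.indicator_of_notMem h3]
      rfl
    rw [hQ A hA, h0, map_zero, ENNReal.ofReal_zero]
  have hmeas : ∀ X : Lp ℝ p μ, AEStronglyMeasurable X Q := fun X =>
    (Lp.stronglyMeasurable X).aestronglyMeasurable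
  have hle := lintegral_le_ofReal_of_nonneg hψ hQ
  have hint0 : ∀ X : Lp ℝ p μ, 0 ≤ X → Integrable X Q := by
    intro X hX
    refine ⟨hmeas X, ?_⟩
    have h0 : 0 ≤ᵐ[Q] X := hac.ae_le (by
      filter_upwards [Lp.coeFn_le _ _ |>.2 hX, Lp.coeFn_zero ℝ p μ] with ω h1 h2
      rwa [h2] at h1)
    rw [hasFiniteIntegral_iff_ofReal h0]
    exact (hle X hX).trans_lt ENNReal.ofReal_lt_top
  have hint : ∀ X : Lp ℝ p μ, Integrable X Q := by
    intro X
    refine (hint0 |X| (abs_nonneg X)).mono (hmeas X) ?_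
    filter_upwards [hac.ae_le (Lp.coeFn_abs X)] with ω h
    rw [h, norm_abs_eq_norm]
  -- The defect is again positive, and it vanishes on indicators. For `p = ∞` it kills the
  -- constants, and `‖X‖ + X ≥ 0` makes it nonnegative everywhere, hence zero. For `p < ∞` it is
  -- continuous and zero on a dense subspace.
  let φ : Lp ℝ p μ →ₗ[ℝ] ℝ :=
    { toFun := fun X => ψ X - ∫ ω, X ω ∂Q
      map_add' := fun X Y => by
        have h : ∫ ω, (X + Y : Lp ℝ p μ) ω ∂Q = ∫ ω, X ω ∂Q + ∫ ω, Y ω ∂Q := by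
          rw [← integral_add (hint X) (hint Y)]
          exact integral_congr_ae (hac.ae_le (Lp.coeFn_add X Y))
        rw [map_add, h]
        ring
      map_smul' := fun c X => by
        have h : ∫ ω, (c • X : Lp ℝ p μ) ω ∂Q = c * ∫ ω, X ω ∂Q := by
          rw [← integral_const_mul]
          exact integral_congr_ae (hac.ae_le (Lp.coeFn_smul c X))
        rw [map_smul, h, RingHom.id_apply, smul_eq_mul, smul_eq_mul]
        ring }
  have hφ : ∀ X, φ X = ψ X - ∫ ω, X ω ∂Q := fun _ => rfl
  have hφ0 : ∀ X, 0 ≤ X → 0 ≤ φ X := by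
    intro X hX
    have h0 : 0 ≤ᵐ[Q] X := hac.ae_le (by
      filter_upwards [Lp.coeFn_le _ _ |>.2 hX, Lp.coeFn_zero ℝ p μ] with ω h1 h2
      rwa [h2] at h1)
    rw [hφ, sub_nonneg, integral_eq_lintegral_of_nonneg_ae h0 (hmeas X)]
    exact ENNReal.toReal_le_of_le_ofReal (hψ X hX) (hle X hX)
  have hφi : ∀ (A : Set Ω) (hA : MeasurableSet A), φ (indLp μ p hA) = 0 := by
    intro A hA
    have h : ∫ ω, (indLp μ p hA) ω ∂Q = Q.real A := by
      rw [← integral_indicator_one hA]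
      exact integral_congr_ae (hac.ae_le indicatorConstLp_coeFn)
    rw [hφ, h, Measure.real, hQ A hA, ENNReal.toReal_ofReal (hψ _ (indLp_nonneg hA)), sub_self]
  have hφz : ∀ X, φ X = 0 := by
    by_cases hp : p = ∞
    · subst hp
      have hbd : ∀ X : Lp ℝ ∞ μ, 0 ≤ φ X := by
        intro X
        have h : 0 ≤ ‖X‖ • indLp μ ∞ MeasurableSet.univ + X := by
          rw [← Lp.coeFn_le]
          filter_upwards [indicatorConstLp_coeFn (p := ∞) (hs := MeasurableSet.univ)
            (hμs := measure_ne_top μ _) (c := (1 : ℝ)), Lp.coeFn_zero ℝ ∞ μ,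
            Lp.coeFn_add (‖X‖ • indLp μ ∞ MeasurableSet.univ) X,
            Lp.coeFn_smul ‖X‖ (indLp μ ∞ MeasurableSet.univ),
            ae_abs_le_norm X] with ω h1 h2 h3 h4 h5
          rw [h2, h3, Pi.add_apply, h4, Pi.smul_apply, h1, Set.indicator_univ, smul_eq_mul, mul_one]
          have := neg_le_of_abs_le h5
          simp only [Pi.zero_apply]
          linarith
        have h' := hφ0 _ h
        rwa [map_add, map_smul, hφi, smul_zero, zero_add] at h'
      intro X
      have := hbd (-X)
      rw [map_neg] at this
      linarith [hbd X]
    · have hc := continuous_of_nonneg φ hφ0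
      intro X
      refine Lp.induction hp (motive := fun X => φ X = 0) ?_ ?_ ?_ X
      · intro c s hs hμs
        have h : (Lp.simpleFunc.indicatorConst p hs hμs.ne c : Lp ℝ p μ) = c • indLp μ p hs := by
          rw [Lp.simpleFunc.coe_indicatorConst]
          ext1
          filter_upwards [indicatorConstLp_coeFn (p := p) (hs := hs) (hμs := hμs.ne) (c := c),
            indicatorConstLp_coeFn (p := p) (hs := hs) (hμs := hμs.ne) (c := (1 : ℝ)),
            Lp.coeFn_smul c (indLp μ p hs)] with ω h1 h2 h3
          classical
          rw [h1, h3, Pi.smul_apply, h2, Set.indicator_apply, Set.indicator_apply]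
          split_ifs <;> simp
        rw [h, map_smul, hφi, smul_zero]
      · intro f g hf hg _ h1 h2
        rw [map_add, h1, h2, add_zero]
      · exact isClosed_eq hc continuous_const
  refine ⟨Q, hfin, hac, fun X => ⟨hint X, ?_⟩⟩
  have := hφz X
  rw [hφ] at this
  linarith

end Representation

variable {Ω : Type*} {m : MeasurableSpace Ω} {T : ℝ}

/-! ### Conditional risk at two dates -/

section TwoDates

variable {P : Measure Ω} {𝓕 : Filtration (Set.Icc (0 : ℝ) T) m} {p : ℝ≥0∞}
  {s t : Set.Icc (0 : ℝ) T}

theorem trim_le_trim (h : s ≤ t) : (P.trim (𝓕.le t)).trim (𝓕.mono h) = P.trim (𝓕.le s) :=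
  trim_trim

theorem ae_trim_of_le (h : s ≤ t) {q : Ω → Prop} (hq : ∀ᵐ ω ∂(P.trim (𝓕.le s)), q ω) :
    ∀ᵐ ω ∂(P.trim (𝓕.le t)), q ω := by
  rw [← trim_le_trim h] at hq
  exact ae_of_ae_trim (𝓕.mono h) hq

theorem coeFn_incl (h : s ≤ t) (Z : LpAt P 𝓕 p s) :
    (incl h Z : Ω → ℝ) =ᵐ[P.trim (𝓕.le t)] Z :=
  MemLp.coeFn_toLp _

theorem incl_neg (h : s ≤ t) (Z : LpAt P 𝓕 p s) : incl h (-Z) = -incl h Z := by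
  ext1
  filter_upwards [coeFn_incl h Z, coeFn_incl h (-Z), Lp.coeFn_neg (incl h Z),
    ae_trim_of_le h (Lp.coeFn_neg Z)] with ω h1 h2 h3 h4
  rw [h2, h3, h4, Pi.neg_apply, Pi.neg_apply, h1]

theorem RiskMeasure.toFun_mono_ae (ρ : RiskMeasure P 𝓕 p) (h : s ≤ t)
    {X Y : LpAt P 𝓕 p t} (hXY : X ≤ Y) :
    ρ.toFun h Y ≤ᵐ[P.trim (𝓕.le s)] ρ.toFun h X :=
  (Lp.coeFn_le _ _).2 (ρ.monotone h Y X hXY)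

variable [IsProbabilityMeasure P]

theorem incl_indLp (h : s ≤ t) {A : Set Ω} (hA : MeasurableSet[𝓕 s] A) :
    incl h (indLp (P.trim (𝓕.le s)) p hA : LpAt P 𝓕 p s)
      = indLp (P.trim (𝓕.le t)) p (𝓕.mono h A hA) := by
  ext1
  filter_upwards [coeFn_incl h (indLp (P.trim (𝓕.le s)) p hA : LpAt P 𝓕 p s),
    ae_trim_of_le h (indicatorConstLp_coeFn (p := p) (hs := hA)
      (hμs := measure_ne_top (P.trim (𝓕.le s)) A) (c := (1 : ℝ))),
    indicatorConstLp_coeFn (p := p) (hs := 𝓕.mono h A hA)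
      (hμs := measure_ne_top (P.trim (𝓕.le t)) A) (c := (1 : ℝ))] with ω h1 h2 h3
  rw [h1, h2, h3]

namespace RiskMeasure

variable (ρ : RiskMeasure P 𝓕 p) [Fact (1 ≤ p)]

theorem integrable_toFun (h : s ≤ t) (X : LpAt P 𝓕 p t) :
    Integrable (ρ.toFun h X) (P.trim (𝓕.le s)) :=
  (Lp.memLp _).integrable Fact.out

theorem convexOn_setIntegral (h : s ≤ t) (B : Set Ω) :
    ConvexOn ℝ Set.univ fun X : LpAt P 𝓕 p t => ∫ ω in B, ρ.toFun h X ω ∂(P.trim (𝓕.le s)) := by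
  refine ⟨convex_univ, fun X _ Y _ a b ha hb hab => ?_⟩
  obtain rfl : b = 1 - a := by linarith
  have hc := (Lp.coeFn_le _ _).2 (ρ.convex h X Y a ha (by linarith))
  have hi : ∀ X, Integrable (ρ.toFun h X) ((P.trim (𝓕.le s)).restrict B) := fun X =>
    (ρ.integrable_toFun h X).restrict
  simp only [smul_eq_mul]
  rw [← integral_const_mul, ← integral_const_mul,
    ← integral_add ((hi X).const_mul a) ((hi Y).const_mul (1 - a))]
  refine integral_mono_ae (hi _) (((hi X).const_mul a).add ((hi Y).const_mul (1 - a)))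
    (ae_restrict_of_ae ?_)
  filter_upwards [hc, Lp.coeFn_add (a • ρ.toFun h X) ((1 - a) • ρ.toFun h Y),
    Lp.coeFn_smul a (ρ.toFun h X), Lp.coeFn_smul (1 - a) (ρ.toFun h Y)] with ω h1 h2 h3 h4
  rw [h2, Pi.add_apply, h3, h4] at h1
  exact h1

theorem setIntegral_add_incl (h : s ≤ t) (B : Set Ω) (X : LpAt P 𝓕 p t) (Z : LpAt P 𝓕 p s) :
    ∫ ω in B, ρ.toFun h (X + incl h Z) ω ∂(P.trim (𝓕.le s))
      = ∫ ω in B, ρ.toFun h X ω ∂(P.trim (𝓕.le s)) - ∫ ω in B, Z ω ∂(P.trim (𝓕.le s)) := by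
  have hZ : Integrable Z (P.trim (𝓕.le s)) := (Lp.memLp _).integrable Fact.out
  rw [ρ.translation_invariant, ← integral_sub (ρ.integrable_toFun h X).restrict hZ.restrict]
  exact integral_congr_ae (ae_restrict_of_ae (Lp.coeFn_sub _ _))

/-- Positivity is monotonicity of ρ. On the F_s-positions the risk is affine, so the subgradient
inequality at both Z and -Z determines the functional there. A general set `B` is allowed because
locality is later read off from small `B`. -/
theorem exists_positive_subgradient (h : s ≤ t) (B : Set Ω) (X : LpAt P 𝓕 p t) :
    ∃ ψ : LpAt P 𝓕 p t →ₗ[ℝ] ℝ, (∀ Y, 0 ≤ Y → 0 ≤ ψ Y) ∧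
      (∀ Y, ∫ ω in B, ρ.toFun h X ω ∂(P.trim (𝓕.le s)) - ψ Y
        ≤ ∫ ω in B, ρ.toFun h (X + Y) ω ∂(P.trim (𝓕.le s))) ∧
      ∀ Z : LpAt P 𝓕 p s, ψ (incl h Z) = ∫ ω in B, Z ω ∂(P.trim (𝓕.le s)) := by
  obtain ⟨φ, hφ⟩ := exists_subgradient (ρ.convexOn_setIntegral h B) X
  refine ⟨-φ, fun Y hY => ?_, fun Y => ?_, fun Z => ?_⟩
  · have h1 : ∫ ω in B, ρ.toFun h (X + Y) ω ∂(P.trim (𝓕.le s))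
        ≤ ∫ ω in B, ρ.toFun h X ω ∂(P.trim (𝓕.le s)) :=
      integral_mono_ae (ρ.integrable_toFun h _).restrict (ρ.integrable_toFun h _).restrict
        (ae_restrict_of_ae (ρ.toFun_mono_ae h (le_add_of_nonneg_right hY)))
    have h2 := hφ Y
    rw [LinearMap.neg_apply]
    linarith
  · have h2 := hφ Y
    rw [LinearMap.neg_apply]
    linarith
  · have h1 := hφ (incl h Z)
    have h2 := hφ (incl h (-Z))
    rw [setIntegral_add_incl] at h1 h2
    have h3 : ∫ ω in B, (-Z) ω ∂(P.trim (𝓕.le s)) = - ∫ ω in B, Z ω ∂(P.trim (𝓕.le s)) := by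
      rw [← integral_neg]
      exact integral_congr_ae (ae_restrict_of_ae (Lp.coeFn_neg Z))
    rw [h3, incl_neg, map_neg] at h2
    rw [LinearMap.neg_apply]
    linarith

theorem tendsto_setIntegral_add_indLp (hp : p = ∞) (h : s ≤ t) (B : Set Ω) (X : LpAt P 𝓕 p t)
    (A : ℕ → Set Ω) (hA : ∀ n, MeasurableSet[𝓕 t] (A n)) (hmono : Monotone A)
    (hU : ⋃ n, A n = Set.univ) :
    Tendsto (fun n => ∫ ω in B, ρ.toFun h (X + indLp (P.trim (𝓕.le t)) p (hA n)) ω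
        ∂(P.trim (𝓕.le s))) atTop
      (𝓝 (∫ ω in B, ρ.toFun h (X + indLp (P.trim (𝓕.le t)) p MeasurableSet.univ) ω
        ∂(P.trim (𝓕.le s)))) := by
  have hco : ∀ {C : Set Ω} (hC : MeasurableSet[𝓕 t] C),
      indLp (P.trim (𝓕.le t)) p hC =ᵐ[P.trim (𝓕.le t)] C.indicator fun _ => (1 : ℝ) :=
    fun hC => indicatorConstLp_coeFn
  have hle : ∀ {C D : Set Ω} (hC : MeasurableSet[𝓕 t] C) (hD : MeasurableSet[𝓕 t] D), C ⊆ D →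
      indLp (P.trim (𝓕.le t)) p hC ≤ indLp (P.trim (𝓕.le t)) p hD := by
    intro C D hC hD hCD
    rw [← Lp.coeFn_le]
    filter_upwards [hco hC, hco hD] with ω h1 h2
    rw [h1, h2]
    exact Set.indicator_le_indicator_of_subset hCD (fun _ => zero_le_one) ω
  have htend := ρ.continuous_from_below hp h
    (fun n => X + indLp (P.trim (𝓕.le t)) p (hA n))
    (X + indLp (P.trim (𝓕.le t)) p MeasurableSet.univ)
    (fun i j hij => add_le_add le_rfl (hle (hA i) (hA j) (hmono hij))) (by
      filter_upwards [ae_all_iff.2 fun n => Lp.coeFn_add X (indLp (P.trim (𝓕.le t)) p (hA n)),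
        ae_all_iff.2 fun n => hco (hA n),
        Lp.coeFn_add X (indLp (P.trim (𝓕.le t)) p MeasurableSet.univ), hco MeasurableSet.univ]
        with ω h1 h2 h3 h4
      obtain ⟨N, hN⟩ := Set.mem_iUnion.1 (hU.symm ▸ Set.mem_univ ω : ω ∈ ⋃ n, A n)
      refine tendsto_const_nhds.congr' ?_
      filter_upwards [eventually_ge_atTop N] with n hn
      rw [h1, h3, Pi.add_apply, Pi.add_apply, h2, h4, Set.indicator_univ,
        Set.indicator_of_mem (hmono hn hN)])
  -- By monotonicity the risks lie between those of `X + 1` and `X`, which provide the integrable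
  -- bound.
  refine tendsto_integral_of_dominated_convergence
    (fun ω => |ρ.toFun h X ω| +
      |ρ.toFun h (X + indLp (P.trim (𝓕.le t)) p MeasurableSet.univ) ω|)
    (fun n => (ρ.integrable_toFun h _).aestronglyMeasurable.restrict)
    (((ρ.integrable_toFun h _).abs.add (ρ.integrable_toFun h _).abs).restrict) (fun n => ?_)
    (ae_restrict_of_ae htend)
  have hU1 : X + indLp (P.trim (𝓕.le t)) p (hA n)
      ≤ X + indLp (P.trim (𝓕.le t)) p MeasurableSet.univ :=
    add_le_add le_rfl (hle (hA n) MeasurableSet.univ (Set.subset_univ _))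
  filter_upwards [ae_restrict_of_ae (ρ.toFun_mono_ae h hU1), ae_restrict_of_ae
    (ρ.toFun_mono_ae h (le_add_of_nonneg_right (indLp_nonneg (hA n)) : X ≤ X + _))] with ω h1 h2
  rw [Real.norm_eq_abs, abs_le]
  constructor
  · linarith [neg_abs_le (ρ.toFun h (X + indLp (P.trim (𝓕.le t)) p MeasurableSet.univ) ω),
      abs_nonneg (ρ.toFun h X ω)]
  · linarith [le_abs_self (ρ.toFun h X ω),
      abs_nonneg (ρ.toFun h (X + indLp (P.trim (𝓕.le t)) p MeasurableSet.univ) ω)]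

theorem exists_measure_subgradient (h : s ≤ t) (B : Set Ω)
    (X : LpAt P 𝓕 p t) :
    ∃ ν : @Measure Ω (𝓕 t), ν ≪ P.trim (𝓕.le t) ∧
      ν.trim (𝓕.mono h) = (P.trim (𝓕.le s)).restrict B ∧
      (∀ Y : LpAt P 𝓕 p t, Integrable Y ν) ∧
      ∀ Y : LpAt P 𝓕 p t, ∫ ω in B, ρ.toFun h X ω ∂(P.trim (𝓕.le s)) - ∫ ω, Y ω ∂ν
        ≤ ∫ ω in B, ρ.toFun h (X + Y) ω ∂(P.trim (𝓕.le s)) := by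
  obtain ⟨ψ, hψ0, hψle, hψincl⟩ := ρ.exists_positive_subgradient h B X
  obtain ⟨ν, hfin, hac, hν⟩ := exists_measure_integral_eq ψ hψ0 (by
    intro A hA hmono hU
    by_cases hp : p = ∞
    · have hlim := (tendsto_const_nhds
        (x := ∫ ω in B, ρ.toFun h X ω ∂(P.trim (𝓕.le s)))).sub
        (ρ.tendsto_setIntegral_add_indLp hp h B X A hA hmono hU)
      have huniv : indLp (P.trim (𝓕.le t)) p MeasurableSet.univ
          = incl h (indLp (P.trim (𝓕.le s)) p MeasurableSet.univ : LpAt P 𝓕 p s) :=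
        (incl_indLp h MeasurableSet.univ).symm
      rw [huniv, setIntegral_add_incl, sub_sub_cancel,
        ← hψincl (indLp (P.trim (𝓕.le s)) p MeasurableSet.univ), ← huniv] at hlim
      -- The subgradient inequality bounds ψ(1_{A_n}) below by a drop in integrated risk. By
      -- continuity from below and translation invariance this drop tends to ψ(1), which is also the
      -- upper bound.
      refine tendsto_of_tendsto_of_tendsto_of_le_of_le hlim tendsto_const_nhds (fun n => ?_)
        (fun n => ?_)
      · have := hψle (indLp (P.trim (𝓕.le t)) p (hA n))
        simp only
        linarith
      · have h1 : indLp (P.trim (𝓕.le t)) p (MeasurableSet.univ (α := Ω))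
            = indLp (P.trim (𝓕.le t)) p (hA n) + indLp (P.trim (𝓕.le t)) p (hA n).compl := by
          rw [← indLp_union (hA n) (hA n).compl disjoint_compl_right]
          congr 1
          exact (Set.union_compl_self _).symm
        have h2 := hψ0 _ (indLp_nonneg (μ := P.trim (𝓕.le t)) (p := p) (hA n).compl)
        simp only
        rw [h1, map_add]
        linarith
    · refine ((continuous_of_nonneg ψ hψ0).tendsto _).comp
        (tendsto_indicatorConstLp_set hp ?_)
      have h1 := tendsto_measure_iInter_atTop (μ := P.trim (𝓕.le t)) (s := fun n => (A n)ᶜ)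
        (fun n => (hA n).compl.nullMeasurableSet)
        (fun i j hij => Set.compl_subset_compl.2 (hmono hij)) ⟨0, measure_ne_top _ _⟩
      rw [← Set.compl_iUnion, hU, Set.compl_univ, measure_empty] at h1
      simpa [symmDiff_def, Set.compl_eq_univ_sdiff, Function.comp_def] using h1)
  refine ⟨ν, hac, ?_, fun Y => (hν Y).1, fun Y => (hν Y).2 ▸ hψle Y⟩
  refine @Measure.ext _ (𝓕 s) _ _ fun C hC => ?_
  have h1 := hψincl (indLp (P.trim (𝓕.le s)) p hC)
  rw [← (hν _).2, incl_indLp] at h1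
  have h2 : ∫ ω, indLp (P.trim (𝓕.le t)) p (𝓕.mono h C hC) ω ∂ν = ν.real C := by
    rw [← integral_indicator_one (𝓕.mono h C hC)]
    exact integral_congr_ae (hac.ae_le indicatorConstLp_coeFn)
  have h3 : ∫ ω in B, indLp (P.trim (𝓕.le s)) p hC ω ∂(P.trim (𝓕.le s))
      = ((P.trim (𝓕.le s)).restrict B).real C := by
    rw [← integral_indicator_one hC]
    exact integral_congr_ae (ae_restrict_of_ae indicatorConstLp_coeFn)
  rw [h2, h3] at h1
  rw [trim_measurableSet_eq _ hC]
  exact (ENNReal.toReal_eq_toReal_iff' (measure_ne_top _ _) (measure_ne_top _ _)).1 h1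

end RiskMeasure

end TwoDates

/-! ### Locality and supporting scenarios -/

namespace RiskMeasure

variable {P : Measure Ω} {𝓕 : Filtration (Set.Icc (0 : ℝ) T) m} {p : ℝ≥0∞}
  {s t : Set.Icc (0 : ℝ) T} [IsProbabilityMeasure P] (ρ : RiskMeasure P 𝓕 p) [Fact (1 ≤ p)]

theorem setIntegral_toFun_le_of_eqOn (h : s ≤ t) {A B : Set Ω} (hA : MeasurableSet[𝓕 s] A)
    (hBA : B ⊆ A) {X Y : LpAt P 𝓕 p t} (hXY : ∀ᵐ ω ∂(P.trim (𝓕.le t)), ω ∈ A → X ω = Y ω) :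
    ∫ ω in B, ρ.toFun h X ω ∂(P.trim (𝓕.le s)) ≤ ∫ ω in B, ρ.toFun h Y ω ∂(P.trim (𝓕.le s)) := by
  obtain ⟨ν, hac, htrim, -, hle⟩ := ρ.exists_measure_subgradient h B X
  have h1 := hle (Y - X)
  -- On F_s the subgradient measure is P restricted to `B ⊆ A`, so it cannot see `Y - X`, which
  -- vanishes on `A`.
  have hAc : ν Aᶜ = 0 := by
    have hd : Aᶜ ∩ B = ∅ := Set.disjoint_iff_inter_eq_empty.1
      (Set.disjoint_left.2 fun ω h1 h2 => h1 (hBA h2))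
    rw [← trim_measurableSet_eq (𝓕.mono h) hA.compl, htrim, Measure.restrict_apply hA.compl, hd,
      measure_empty]
  have h2 : ∫ ω, (Y - X : LpAt P 𝓕 p t) ω ∂ν = 0 := by
    refine integral_eq_zero_of_ae ?_
    filter_upwards [hac.ae_le hXY, hac.ae_le (Lp.coeFn_sub Y X),
      measure_eq_zero_iff_ae_notMem.1 hAc] with ω h1 h2 h3
    rw [h2, Pi.sub_apply, h1 (Set.notMem_compl_iff.1 h3), sub_self, Pi.zero_apply]
  rwa [h2, sub_zero, add_sub_cancel] at h1

/-- The locality property of a conditional risk measure. -/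
theorem toFun_ae_eq_of_eqOn (h : s ≤ t) {A : Set Ω} (hA : MeasurableSet[𝓕 s] A)
    {X Y : LpAt P 𝓕 p t} (hXY : ∀ᵐ ω ∂(P.trim (𝓕.le t)), ω ∈ A → X ω = Y ω) :
    ∀ᵐ ω ∂(P.trim (𝓕.le s)), ω ∈ A → ρ.toFun h X ω = ρ.toFun h Y ω := by
  rw [← ae_restrict_iff' hA]
  refine (ρ.integrable_toFun h X).restrict.ae_eq_of_forall_setIntegral_eq _ _
    (ρ.integrable_toFun h Y).restrict fun C hC _ => ?_
  rw [Measure.restrict_restrict hC]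
  exact le_antisymm (ρ.setIntegral_toFun_le_of_eqOn h hA Set.inter_subset_right hXY)
    (ρ.setIntegral_toFun_le_of_eqOn h hA Set.inter_subset_right
      (hXY.mono fun ω h1 h2 => (h1 h2).symm))

/-- Every position has a scenario at which the dual representation is attained. -/
theorem exists_supporting_scenario (h : s ≤ t) (X : LpAt P 𝓕 p t) :
    ∃ Q ∈ scenarios P 𝓕 h, (∀ Y : LpAt P 𝓕 p t, Integrable Y Q) ∧
      ∀ Y : LpAt P 𝓕 p t, ∀ᵐ ω ∂(P.trim (𝓕.le s)),
        ρ.toFun h X ω + (Q[X | 𝓕 s]) ω ≤ ρ.toFun h Y ω + (Q[Y | 𝓕 s]) ω := by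
  obtain ⟨Q, hac, htrim, hint, hle⟩ := ρ.exists_measure_subgradient h Set.univ X
  rw [Measure.restrict_univ] at htrim
  have hfinite : SigmaFinite (Q.trim (𝓕.mono h)) := by rw [htrim]; infer_instance
  refine ⟨Q, ⟨hac, htrim⟩, hint, fun Y => ?_⟩
  have hcint : ∀ Y : LpAt P 𝓕 p t, Integrable (Q[Y | 𝓕 s]) (P.trim (𝓕.le s)) := fun Y => by
    rw [← htrim]
    exact integrable_condExp.trim (𝓕.mono h) stronglyMeasurable_condExp
  have hset : ∀ (Y : LpAt P 𝓕 p t) (A : Set Ω), MeasurableSet[𝓕 s] A →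
      ∫ ω in A, (Q[Y | 𝓕 s]) ω ∂(P.trim (𝓕.le s)) = ∫ ω in A, Y ω ∂Q := fun Y A hA => by
    rw [← htrim, ← setIntegral_trim (𝓕.mono h) stronglyMeasurable_condExp hA,
      setIntegral_condExp (𝓕.mono h) (hint Y) hA]
  refine ae_le_of_forall_setIntegral_le ((ρ.integrable_toFun h X).add (hcint X))
    ((ρ.integrable_toFun h Y).add (hcint Y)) fun A hA _ => ?_
  rw [integral_add (ρ.integrable_toFun h X).restrict (hcint X).restrict,
    integral_add (ρ.integrable_toFun h Y).restrict (hcint Y).restrict, hset X A hA, hset Y A hA]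
  have hA' : MeasurableSet[𝓕 t] A := 𝓕.mono h A hA
  -- `X + D` is `Y` on `A` and `X` off `A`. By locality the integrated inequality for `D` becomes
  -- the inequality for `Y` on `A` alone.
  let D : LpAt P 𝓕 p t := ((Lp.memLp (Y - X)).indicator hA').toLp _
  have hD : D =ᵐ[P.trim (𝓕.le t)] A.indicator (Y - X : LpAt P 𝓕 p t) := MemLp.coeFn_toLp _
  have hDA : ∀ᵐ ω ∂(P.trim (𝓕.le t)), ω ∈ A → (X + D : LpAt P 𝓕 p t) ω = Y ω := by
    filter_upwards [hD, Lp.coeFn_add X D, Lp.coeFn_sub Y X] with ω h1 h2 h3 h4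
    rw [h2, Pi.add_apply, h1, Set.indicator_of_mem h4, h3, Pi.sub_apply, add_sub_cancel]
  have hDAc : ∀ᵐ ω ∂(P.trim (𝓕.le t)), ω ∈ Aᶜ → (X + D : LpAt P 𝓕 p t) ω = X ω := by
    filter_upwards [hD, Lp.coeFn_add X D] with ω h1 h2 h4
    rw [h2, Pi.add_apply, h1, Set.indicator_of_notMem h4, add_zero]
  have hi1 : ∫ ω, D ω ∂Q = ∫ ω in A, Y ω ∂Q - ∫ ω in A, X ω ∂Q := by
    rw [integral_congr_ae (hac.ae_le hD), integral_indicator hA',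
      ← integral_sub (hint Y).restrict (hint X).restrict]
    exact integral_congr_ae (ae_restrict_of_ae (hac.ae_le (Lp.coeFn_sub Y X)))
  have hi2 : ∫ ω in A, ρ.toFun h (X + D) ω ∂(P.trim (𝓕.le s))
      = ∫ ω in A, ρ.toFun h Y ω ∂(P.trim (𝓕.le s)) :=
    setIntegral_congr_ae hA (ρ.toFun_ae_eq_of_eqOn h hA hDA)
  have hi3 : ∫ ω in Aᶜ, ρ.toFun h (X + D) ω ∂(P.trim (𝓕.le s))
      = ∫ ω in Aᶜ, ρ.toFun h X ω ∂(P.trim (𝓕.le s)) :=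
    setIntegral_congr_ae hA.compl (ρ.toFun_ae_eq_of_eqOn h hA.compl hDAc)
  have h1 := hle D
  rw [Measure.restrict_univ, hi1, ← integral_add_compl hA (ρ.integrable_toFun h X),
    ← integral_add_compl hA (ρ.integrable_toFun h (X + D)), hi2, hi3] at h1
  linarith

end RiskMeasure

/-! ### Extended conditional expectations under scenarios -/

theorem extCondExp_neg_coe (m₁ : MeasurableSpace Ω) {m₂ : MeasurableSpace Ω} (Q : @Measure Ω m₂)
    (X : Ω → ℝ) :
    extCondExp m₁ Q (fun ω => ((-X ω : ℝ) : EReal)) = fun ω =>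
      (condLExp m₁ Q (fun ω => ENNReal.ofReal (-X ω)) ω : EReal)
        - (condLExp m₁ Q (fun ω => ENNReal.ofReal (X ω)) ω : EReal) := by
  ext ω
  simp only [extCondExp, ← EReal.coe_neg, neg_neg, EReal.toENNReal_of_ne_top (EReal.coe_ne_top _),
    EReal.toReal_coe]

theorem extCondExp_neg_coe_ae_eq {m₁ m₂ : MeasurableSpace Ω} (hm : m₁ ≤ m₂) {Q : @Measure Ω m₂}
    [IsFiniteMeasure Q] {X : Ω → ℝ} (hX : Integrable X Q) :
    extCondExp m₁ Q (fun ω => ((-X ω : ℝ) : EReal))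
      =ᵐ[Q.trim hm] fun ω => ((-(Q[X | m₁]) ω : ℝ) : EReal) := by
  have key : ∀ Y : Ω → ℝ, Integrable Y Q → ∀ᵐ ω ∂(Q.trim hm),
      condLExp m₁ Q (fun ω => ENNReal.ofReal (Y ω)) ω
        = ENNReal.ofReal ((Q[fun ω => max (Y ω) 0 | m₁]) ω) ∧
      0 ≤ (Q[fun ω => max (Y ω) 0 | m₁]) ω := by
    intro Y hY
    have h0 : 0 ≤ᵐ[Q] fun ω => max (Y ω) 0 := ae_of_all _ fun ω => le_max_right _ _
    have h1 := condLExp_ofReal m₁ hY.pos_part h0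
    simp only [ENNReal.ofReal_max, ENNReal.ofReal_zero, zero_le, max_eq_left] at h1
    refine Eventually.and ?_ ?_
    · exact ae_eq_trim_of_measurable hm (measurable_condLExp _ _ _)
        (stronglyMeasurable_condExp.measurable.ennreal_ofReal) h1
    · exact StronglyMeasurable.ae_le_trim_of_stronglyMeasurable hm stronglyMeasurable_zero
        stronglyMeasurable_condExp (condExp_nonneg h0)
  have hsub : Q[fun ω => max (X ω) 0 | m₁] - Q[fun ω => max (-X ω) 0 | m₁]
      =ᵐ[Q.trim hm] Q[X | m₁] := by
    refine StronglyMeasurable.ae_eq_trim_of_stronglyMeasurable hm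
      (stronglyMeasurable_condExp.sub stronglyMeasurable_condExp) stronglyMeasurable_condExp ?_
    refine (condExp_sub hX.pos_part hX.neg_part m₁).symm.trans (ae_of_all _ fun ω => ?_)
    congr 2
    ext ω
    exact max_zero_sub_max_neg_zero_eq_self (X ω)
  rw [extCondExp_neg_coe]
  filter_upwards [key X hX, key (fun ω => -X ω) hX.neg, hsub] with ω h1 h2 h3
  rw [h1.1, h2.1, ← h3, EReal.coe_ennreal_ofReal, EReal.coe_ennreal_ofReal, max_eq_left h1.2,
    max_eq_left h2.2, ← EReal.coe_sub, Pi.sub_apply, neg_sub]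

section

variable {P : Measure Ω} {𝓕 : Filtration (Set.Icc (0 : ℝ) T) m} {s t : Set.Icc (0 : ℝ) T}

theorem condLExp_ae_eq_of_scenario {h : s ≤ t} {Q : @Measure Ω (𝓕 t)}
    (hQ : Q ∈ scenarios P 𝓕 h) {X Y : Ω → ℝ≥0∞} (hXY : X =ᵐ[P.trim (𝓕.le t)] Y) :
    condLExp (𝓕 s) Q X =ᵐ[P.trim (𝓕.le s)] condLExp (𝓕 s) Q Y := by
  rw [← hQ.2]
  exact condLExp_congr_ae_trim (𝓕.mono h) (hQ.1.ae_le hXY)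

theorem condLExp_zero_of_scenario {p : ℝ≥0∞} {h : s ≤ t} {Q : @Measure Ω (𝓕 t)}
    (hQ : Q ∈ scenarios P 𝓕 h) : ∀ᵐ ω ∂(P.trim (𝓕.le s)),
      condLExp (𝓕 s) Q (fun ω => ENNReal.ofReal (-(0 : LpAt P 𝓕 p t) ω)) ω = 0 ∧
      condLExp (𝓕 s) Q (fun ω => ENNReal.ofReal ((0 : LpAt P 𝓕 p t) ω)) ω = 0 := by
  have h1 : (fun ω => ENNReal.ofReal (-(0 : LpAt P 𝓕 p t) ω))
      =ᵐ[P.trim (𝓕.le t)] (0 : Ω → ℝ≥0∞) :=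
    (Lp.coeFn_zero ℝ p (P.trim (𝓕.le t))).mono fun ω h => by
      rw [Pi.zero_apply] at h
      simp only [h, neg_zero, ENNReal.ofReal_zero, Pi.zero_apply]
  have h2 : (fun ω => ENNReal.ofReal ((0 : LpAt P 𝓕 p t) ω))
      =ᵐ[P.trim (𝓕.le t)] (0 : Ω → ℝ≥0∞) :=
    (Lp.coeFn_zero ℝ p (P.trim (𝓕.le t))).mono fun ω h => by
      rw [Pi.zero_apply] at h
      simp only [h, ENNReal.ofReal_zero, Pi.zero_apply]
  filter_upwards [condLExp_ae_eq_of_scenario hQ h1, condLExp_ae_eq_of_scenario hQ h2]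
    with ω h3 h4
  rw [h3, h4, condLExp_zero]
  exact ⟨rfl, rfl⟩

theorem condLExp_add_of_scenario {h : s ≤ t} {Q : @Measure Ω (𝓕 t)}
    (hQ : Q ∈ scenarios P 𝓕 h) {X : Ω → ℝ≥0∞} (hX : Measurable[𝓕 t] X) (Y : Ω → ℝ≥0∞) :
    condLExp (𝓕 s) Q (fun ω => X ω + Y ω)
      =ᵐ[P.trim (𝓕.le s)] fun ω => condLExp (𝓕 s) Q X ω + condLExp (𝓕 s) Q Y ω := by
  rw [← hQ.2]
  refine ae_eq_trim_of_measurable (𝓕.mono h) (measurable_condLExp _ _ _)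
    ((measurable_condLExp _ _ _).add (measurable_condLExp _ _ _)) ?_
  exact condLExp_add_left Y hX.aemeasurable

variable [IsProbabilityMeasure P]

theorem isFiniteMeasure_of_mem_scenarios {h : s ≤ t} {Q : @Measure Ω (𝓕 t)}
    (hQ : Q ∈ scenarios P 𝓕 h) : IsFiniteMeasure Q := ⟨by
  rw [← trim_measurableSet_eq (𝓕.mono h) MeasurableSet.univ, hQ.2]
  exact measure_lt_top _ _⟩

theorem condLExp_mono_of_scenario {h : s ≤ t} {Q : @Measure Ω (𝓕 t)}
    (hQ : Q ∈ scenarios P 𝓕 h) {X Y : Ω → ℝ≥0∞} (hXY : X ≤ᵐ[Q] Y) :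
    condLExp (𝓕 s) Q X ≤ᵐ[P.trim (𝓕.le s)] condLExp (𝓕 s) Q Y := by
  have := isFiniteMeasure_of_mem_scenarios hQ
  rw [← hQ.2]
  refine StronglyMeasurable.ae_le_trim_of_stronglyMeasurable (𝓕.mono h)
    (Measurable.stronglyMeasurable ?_) (Measurable.stronglyMeasurable ?_) (condLExp_mono hXY)
  · exact measurable_condLExp _ _ _
  · exact measurable_condLExp _ _ _

end

/-! ### Penalties and attainment of the dual representation -/

namespace RiskMeasure

variable {P : Measure Ω} {𝓕 : Filtration (Set.Icc (0 : ℝ) T) m} {p : ℝ≥0∞}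
  {s t : Set.Icc (0 : ℝ) T} [IsProbabilityMeasure P] (ρ : RiskMeasure P 𝓕 p)

theorem sub_toFun_le_penalty (h : s ≤ t) (Q : @Measure Ω (𝓕 t)) (X : LpAt P 𝓕 p t) :
    ∀ᵐ ω ∂(P.trim (𝓕.le s)),
      (condLExp (𝓕 s) Q (fun ω => ENNReal.ofReal (-X ω)) ω : EReal)
        - (condLExp (𝓕 s) Q (fun ω => ENNReal.ofReal (X ω)) ω : EReal)
        - ((ρ.toFun h X ω : ℝ) : EReal) ≤ ρ.penalty h Q ω := by
  have h1 := (isEssSup_essSupFamily (P.trim (𝓕.le s)) fun (X : LpAt P 𝓕 p t) ω =>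
    extCondExp (𝓕 s) Q (fun ω' => ((-X ω' : ℝ) : EReal)) ω - ((ρ.toFun h X ω : ℝ) : EReal)).le X
  rw [extCondExp_neg_coe] at h1
  exact h1

theorem measurable_penalty (h : s ≤ t) (Q : @Measure Ω (𝓕 t)) :
    Measurable[𝓕 s] (ρ.penalty h Q) :=
  (isEssSup_essSupFamily (P.trim (𝓕.le s)) _).measurable

theorem isOptimalScenario_iff (h : s ≤ t) (X : LpAt P 𝓕 p t) (Q : @Measure Ω (𝓕 t)) :
    ρ.IsOptimalScenario h X Q ↔ Q ∈ scenarios P 𝓕 h ∧ ∀ᵐ ω ∂(P.trim (𝓕.le s)),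
      ((ρ.toFun h X ω : ℝ) : EReal) =
        (condLExp (𝓕 s) Q (fun ω => ENNReal.ofReal (-X ω)) ω : EReal)
        - (condLExp (𝓕 s) Q (fun ω => ENNReal.ofReal (X ω)) ω : EReal) - ρ.penalty h Q ω := by
  rw [IsOptimalScenario, extCondExp_neg_coe]

variable {ρ}

/-- The penalty of a scenario bounds the conditional expectations of absolute values. -/
theorem condLExp_abs_sub_le_penalty {h : s ≤ t} {Q : @Measure Ω (𝓕 t)}
    (hQ : Q ∈ scenarios P 𝓕 h) (X : LpAt P 𝓕 p t) :
    ∀ᵐ ω ∂(P.trim (𝓕.le s)),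
      (condLExp (𝓕 s) Q (fun ω => ENNReal.ofReal |X ω|) ω : EReal)
        - ((ρ.toFun h (-|X|) ω : ℝ) : EReal) ≤ ρ.penalty h Q ω := by
  have hX : ∀ᵐ ω ∂(P.trim (𝓕.le t)), (-|X| : LpAt P 𝓕 p t) ω = -|X ω| := by
    filter_upwards [Lp.coeFn_neg |X|, Lp.coeFn_abs X] with ω h1 h2
    rw [h1, Pi.neg_apply, h2]
  have h1 : (fun ω => ENNReal.ofReal (-(-|X| : LpAt P 𝓕 p t) ω))
      =ᵐ[P.trim (𝓕.le t)] fun ω => ENNReal.ofReal |X ω| :=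
    hX.mono fun ω h => by simp only [h, neg_neg]
  have h2 : (fun ω => ENNReal.ofReal ((-|X| : LpAt P 𝓕 p t) ω))
      =ᵐ[P.trim (𝓕.le t)] (0 : Ω → ℝ≥0∞) :=
    hX.mono fun ω h => by
      simp only [h, Pi.zero_apply, ENNReal.ofReal_eq_zero]
      exact neg_nonpos.2 (abs_nonneg _)
  filter_upwards [ρ.sub_toFun_le_penalty h Q (-|X|), condLExp_ae_eq_of_scenario hQ h1,
    condLExp_ae_eq_of_scenario hQ h2] with ω h3 h4 h5
  rwa [h4, h5, condLExp_zero, Pi.zero_apply, EReal.coe_ennreal_zero, sub_zero] at h3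

theorem neg_toFun_zero_le_penalty {h : s ≤ t} {Q : @Measure Ω (𝓕 t)}
    (hQ : Q ∈ scenarios P 𝓕 h) :
    ∀ᵐ ω ∂(P.trim (𝓕.le s)), ((-ρ.toFun h 0 ω : ℝ) : EReal) ≤ ρ.penalty h Q ω := by
  filter_upwards [ρ.sub_toFun_le_penalty h Q 0, condLExp_zero_of_scenario (p := p) hQ]
    with ω h1 h2
  rwa [h2.1, h2.2, EReal.coe_ennreal_zero, sub_zero, zero_sub, ← EReal.coe_neg] at h1

theorem condLExp_abs_ne_top {h : s ≤ t} {Q : @Measure Ω (𝓕 t)}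
    (hQ : Q ∈ scenarios P 𝓕 h) (X : LpAt P 𝓕 p t) :
    ∀ᵐ ω ∂(P.trim (𝓕.le s)), ρ.penalty h Q ω ≠ ⊤ →
      condLExp (𝓕 s) Q (fun ω => ENNReal.ofReal |X ω|) ω ≠ ∞ := by
  filter_upwards [condLExp_abs_sub_le_penalty (ρ := ρ) hQ X] with ω h1 h2 h3
  rw [h3, EReal.coe_ennreal_top, EReal.top_sub_coe, top_le_iff] at h1
  exact h2 h1

theorem condLExp_le_condLExp_abs {h : s ≤ t} {Q : @Measure Ω (𝓕 t)}
    (hQ : Q ∈ scenarios P 𝓕 h) (X : Ω → ℝ) :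
    ∀ᵐ ω ∂(P.trim (𝓕.le s)),
      condLExp (𝓕 s) Q (fun ω => ENNReal.ofReal (-X ω)) ω
        ≤ condLExp (𝓕 s) Q (fun ω => ENNReal.ofReal |X ω|) ω ∧
      condLExp (𝓕 s) Q (fun ω => ENNReal.ofReal (X ω)) ω
        ≤ condLExp (𝓕 s) Q (fun ω => ENNReal.ofReal |X ω|) ω := by
  refine Eventually.and ?_ ?_
  · exact condLExp_mono_of_scenario hQ
      (ae_of_all _ fun ω => ENNReal.ofReal_le_ofReal (neg_le_abs _))
  · exact condLExp_mono_of_scenario hQ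
      (ae_of_all _ fun ω => ENNReal.ofReal_le_ofReal (le_abs_self _))

variable (ρ) [Fact (1 ≤ p)]

/-- The supporting inequality says that `X` attains the essential supremum in the penalty of `Q`.
The penalty is therefore E_Q[-X | F_s] - ρ_st(X), which is integrable. -/
theorem exists_optimalScenario (h : s ≤ t) (X : LpAt P 𝓕 p t) :
    ∃ Q, ρ.IsOptimalScenario h X Q ∧ ρ.HasFiniteMeanPenalty h Q := by
  obtain ⟨Q, hQ, hint, hsupp⟩ := ρ.exists_supporting_scenario h X
  have := isFiniteMeasure_of_mem_scenarios hQ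
  have hext : ∀ Y : LpAt P 𝓕 p t, extCondExp (𝓕 s) Q (fun ω => ((-Y ω : ℝ) : EReal))
      =ᵐ[P.trim (𝓕.le s)] fun ω => ((-(Q[Y | 𝓕 s]) ω : ℝ) : EReal) := fun Y => by
    rw [← hQ.2]
    exact extCondExp_neg_coe_ae_eq (𝓕.mono h) (hint Y)
  have hsup := isEssSup_essSupFamily (P.trim (𝓕.le s)) fun (X : LpAt P 𝓕 p t) ω =>
    extCondExp (𝓕 s) Q (fun ω' => ((-X ω' : ℝ) : EReal)) ω - ((ρ.toFun h X ω : ℝ) : EReal)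
  have hpen : ∀ᵐ ω ∂(P.trim (𝓕.le s)), ρ.penalty h Q ω
      = ((-(Q[X | 𝓕 s]) ω - ρ.toFun h X ω : ℝ) : EReal) := by
    have hle := hsup.least (fun ω => ((-(Q[X | 𝓕 s]) ω - ρ.toFun h X ω : ℝ) : EReal))
      ((stronglyMeasurable_condExp.measurable.neg.sub
        (Lp.stronglyMeasurable _).measurable).coe_real_ereal) (fun Y => by
        filter_upwards [hext Y, hsupp Y] with ω h1 h2
        rw [h1, ← EReal.coe_sub, EReal.coe_le_coe_iff]
        linarith)
    filter_upwards [hle, hsup.le X, hext X] with ω h1 h2 h3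
    refine le_antisymm h1 ?_
    rwa [h3, ← EReal.coe_sub] at h2
  refine ⟨Q, ⟨hQ, ?_⟩, ?_⟩
  · filter_upwards [hpen, hext X] with ω h1 h2
    rw [h1, h2, ← EReal.coe_sub, sub_sub_cancel]
  · have hi : Integrable (fun ω => -(Q[X | 𝓕 s]) ω - ρ.toFun h X ω) (P.trim (𝓕.le s)) := by
      refine Integrable.sub (Integrable.neg ?_) (ρ.integrable_toFun h X)
      rw [← hQ.2]
      exact integrable_condExp.trim (𝓕.mono h) stronglyMeasurable_condExp
    refine lt_of_le_of_lt (lintegral_mono_ae ?_) hi.2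
    filter_upwards [hpen] with ω h1
    rw [h1, EReal.toENNReal_of_ne_top (EReal.coe_ne_top _), EReal.toReal_coe]
    exact Real.ofReal_le_enorm _

/-- The position 0 bounds every penalty below by -ρ(0), and an optimal scenario for 0 attains the
bound. -/
theorem minPenalty_ae_eq (h : s ≤ t) :
    ∀ᵐ ω ∂(P.trim (𝓕.le s)), ρ.minPenalty h ω = ((-ρ.toFun h 0 ω : ℝ) : EReal) := by
  obtain ⟨R, hR, -⟩ := ρ.exists_optimalScenario h 0
  have hsup := isEssSup_essSupFamily (P.trim (𝓕.le s))
    fun (R : scenarios P 𝓕 h) ω => - ρ.penalty h R.1 ω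
  have hle := hsup.least (fun ω => ((ρ.toFun h 0 ω : ℝ) : EReal))
    ((Lp.stronglyMeasurable _).measurable.coe_real_ereal) (fun R => by
      filter_upwards [neg_toFun_zero_le_penalty (ρ := ρ) R.2] with ω h1
      rw [EReal.neg_le, ← EReal.coe_neg]
      exact h1)
  filter_upwards [hle, hsup.le ⟨R, hR.1⟩, ((ρ.isOptimalScenario_iff h 0 R).1 hR).2,
    condLExp_zero_of_scenario (p := p) hR.1] with ω h1 h2 h3 h4
  rw [h4.1, h4.2, EReal.coe_ennreal_zero, sub_zero, zero_sub] at h3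
  rw [minPenalty, essInfFamily, EReal.coe_neg, neg_inj]
  exact le_antisymm h1 (h3 ▸ h2)

end RiskMeasure

/-! ### Pasting of scenarios -/

theorem measurable_indicator_one {m₁ : MeasurableSpace Ω} {A : Set Ω}
    (hA : MeasurableSet[m₁] A) : Measurable[m₁] (A.indicator (1 : Ω → ℝ≥0∞)) :=
  Measurable.indicator (@measurable_const _ _ _ m₁ 1) hA

/-- The measures with densities `condLExp m₁ R Y` and `Y` agree on `m₁`, so they integrate `g`
equally. -/
theorem lintegral_mul_condLExp {m₁ m₂ : MeasurableSpace Ω} (hm : m₁ ≤ m₂) (R : @Measure Ω m₂)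
    [IsFiniteMeasure R] {g Y : Ω → ℝ≥0∞} (hg : Measurable[m₁] g) (hY : Measurable[m₂] Y) :
    ∫⁻ ω, g ω * condLExp m₁ R Y ω ∂ R = ∫⁻ ω, g ω * Y ω ∂ R := by
  have hC : Measurable[m₂] (condLExp m₁ R Y) := measurable_condLExp' _ _ _
  have h : (R.withDensity (condLExp m₁ R Y)).trim hm = (R.withDensity Y).trim hm := by
    refine @Measure.ext _ m₁ _ _ fun A hA => ?_
    rw [trim_measurableSet_eq hm hA, trim_measurableSet_eq hm hA,
      withDensity_apply _ (hm A hA), withDensity_apply _ (hm A hA), setLIntegral_condLExp hm R Y hA]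
  have h1 := lintegral_trim (μ := R.withDensity Y) hm hg
  rw [← h, lintegral_trim hm hg, lintegral_withDensity_eq_lintegral_mul _ hC (hg.mono hm le_rfl),
    lintegral_withDensity_eq_lintegral_mul _ hY (hg.mono hm le_rfl)] at h1
  simpa only [Pi.mul_apply, mul_comm] using h1

section

variable {P : Measure Ω} {𝓕 : Filtration (Set.Icc (0 : ℝ) T) m} {s t u : Set.Icc (0 : ℝ) T}

theorem lintegral_trim_scenario (htu : t ≤ u) {R : @Measure Ω (𝓕 u)}
    (hR : R ∈ scenarios P 𝓕 htu) {Y : Ω → ℝ≥0∞} (hY : Measurable[𝓕 t] Y) :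
    ∫⁻ ω, Y ω ∂ R = ∫⁻ ω, Y ω ∂(P.trim (𝓕.le t)) := by
  rw [← hR.2, lintegral_trim _ hY]

variable [IsProbabilityMeasure P]

theorem lintegral_pasting (htu : t ≤ u) (Q : @Measure Ω (𝓕 u)) {R : @Measure Ω (𝓕 u)}
    (hR : R ∈ scenarios P 𝓕 htu) {Y : Ω → ℝ≥0∞} (hY : Measurable[𝓕 u] Y) :
    ∫⁻ ω, Y ω ∂(pasting P 𝓕 htu Q R)
      = ∫⁻ ω, (Q.trim (𝓕.mono htu)).rnDeriv (P.trim (𝓕.le t)) ω * Y ω ∂ R := by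
  have := isFiniteMeasure_of_mem_scenarios hR
  have hZ : Measurable[𝓕 u] ((Q.trim (𝓕.mono htu)).rnDeriv (P.trim (𝓕.le t))) :=
    (Measure.measurable_rnDeriv _ _).mono (𝓕.mono htu) le_rfl
  have hg : Measurable[𝓕 u] fun ω => (Q.trim (𝓕.mono htu)).rnDeriv (P.trim (𝓕.le t)) ω *
    R.rnDeriv (P.trim (𝓕.le u)) ω := hZ.mul (Measure.measurable_rnDeriv _ _)
  have hgY : Measurable[𝓕 u] fun ω =>
    (Q.trim (𝓕.mono htu)).rnDeriv (P.trim (𝓕.le t)) ω * Y ω := hZ.mul hY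
  rw [pasting, lintegral_withDensity_eq_lintegral_mul _ hg hY, ← lintegral_rnDeriv_mul hR.1
    hgY.aemeasurable]
  refine lintegral_congr fun ω => ?_
  simp only [Pi.mul_apply]
  ring

theorem lintegral_rnDeriv_trim_mul (htu : t ≤ u) {Q : @Measure Ω (𝓕 u)} [IsFiniteMeasure Q]
    (hQ : Q ≪ P.trim (𝓕.le u)) {Y : Ω → ℝ≥0∞} (hY : Measurable[𝓕 t] Y) :
    ∫⁻ ω, (Q.trim (𝓕.mono htu)).rnDeriv (P.trim (𝓕.le t)) ω * Y ω ∂(P.trim (𝓕.le t))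
      = ∫⁻ ω, Y ω ∂Q := by
  have hac : Q.trim (𝓕.mono htu) ≪ P.trim (𝓕.le t) := by
    rw [← trim_le_trim htu]
    exact hQ.trim _
  rw [lintegral_rnDeriv_mul hac hY.aemeasurable, lintegral_trim _ hY]

theorem pasting_trim (htu : t ≤ u) {Q R : @Measure Ω (𝓕 u)} [IsFiniteMeasure Q]
    (hQ : Q ≪ P.trim (𝓕.le u)) (hR : R ∈ scenarios P 𝓕 htu) :
    (pasting P 𝓕 htu Q R).trim (𝓕.mono htu) = Q.trim (𝓕.mono htu) := by
  refine @Measure.ext _ (𝓕 t) _ _ fun A hA => ?_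
  have hA1 : Measurable[𝓕 t] (A.indicator (1 : Ω → ℝ≥0∞)) := measurable_indicator_one hA
  have hZA : Measurable[𝓕 t] fun ω => (Q.trim (𝓕.mono htu)).rnDeriv (P.trim (𝓕.le t)) ω *
    A.indicator (1 : Ω → ℝ≥0∞) ω := (Measure.measurable_rnDeriv _ _).mul hA1
  rw [trim_measurableSet_eq _ hA, trim_measurableSet_eq _ hA,
    ← lintegral_indicator_one (𝓕.mono htu A hA), ← lintegral_indicator_one (𝓕.mono htu A hA),
    lintegral_pasting htu Q hR (hA1.mono (𝓕.mono htu) le_rfl),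
    lintegral_trim_scenario htu hR hZA,
    lintegral_rnDeriv_trim_mul htu hQ hA1]

theorem pasting_mem_scenarios (hst : s ≤ t) (htu : t ≤ u) {Q R : @Measure Ω (𝓕 u)}
    (hQ : Q ∈ scenarios P 𝓕 (hst.trans htu)) (hR : R ∈ scenarios P 𝓕 htu) :
    pasting P 𝓕 htu Q R ∈ scenarios P 𝓕 (hst.trans htu) := by
  have := isFiniteMeasure_of_mem_scenarios hQ
  refine ⟨withDensity_absolutelyContinuous _ _, ?_⟩
  rw [← hQ.2, ← trim_trim (hm₁₂ := 𝓕.mono hst) (hm₂ := 𝓕.mono htu), pasting_trim htu hQ.1 hR,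
    trim_trim]

/-- The tower property of conditional expectations under a pasted measure. -/
theorem condLExp_pasting (hst : s ≤ t) (htu : t ≤ u) {Q R : @Measure Ω (𝓕 u)}
    (hQ : Q ∈ scenarios P 𝓕 (hst.trans htu)) (hR : R ∈ scenarios P 𝓕 htu) {Y : Ω → ℝ≥0∞}
    (hY : Measurable[𝓕 u] Y) :
    condLExp (𝓕 s) (pasting P 𝓕 htu Q R) Y
      =ᵐ[P.trim (𝓕.le s)] condLExp (𝓕 s) Q (condLExp (𝓕 t) R Y) := by
  have := isFiniteMeasure_of_mem_scenarios hQ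
  have := isFiniteMeasure_of_mem_scenarios hR
  have hS := pasting_mem_scenarios hst htu hQ hR
  have := isFiniteMeasure_of_mem_scenarios hS
  have hsu := hst.trans htu
  rw [← hS.2]
  refine ae_eq_trim_of_measurable (𝓕.mono hsu) (measurable_condLExp _ _ _)
    (measurable_condLExp _ _ _) (ae_eq_condLExp (𝓕.mono hsu) _ _ (measurable_condLExp _ _ _)
      fun A hA => ?_).symm
  have hC : Measurable[𝓕 t] (condLExp (𝓕 t) R Y) := measurable_condLExp _ _ _
  have hAt : MeasurableSet[𝓕 t] A := 𝓕.mono hst A hA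
  have hAu : MeasurableSet[𝓕 u] A := 𝓕.mono hsu A hA
  have hZ : Measurable[𝓕 t] ((Q.trim (𝓕.mono htu)).rnDeriv (P.trim (𝓕.le t))) :=
    Measure.measurable_rnDeriv _ _
  have hZC : Measurable[𝓕 t] fun ω => (Q.trim (𝓕.mono htu)).rnDeriv (P.trim (𝓕.le t)) ω *
    A.indicator (condLExp (𝓕 t) R Y) ω := hZ.mul (hC.indicator hAt)
  have hind : ∀ (Z Y : Ω → ℝ≥0∞) ω, Z ω * A.indicator Y ω = A.indicator Z ω * Y ω := by
    intro Z Y ω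
    by_cases h : ω ∈ A <;> simp [h]
  -- S and Q both equal P on F_s, which allows the outer expectation to be computed under Q. On F_t,
  -- Q has density Z_t with respect to P, and P equals R there; this brings both sides to integrals
  -- under R.
  rw [← setLIntegral_trim (𝓕.mono hsu) (measurable_condLExp _ _ _) hA, hS.2, ← hQ.2,
    setLIntegral_trim (𝓕.mono hsu) (measurable_condLExp _ _ _) hA,
    setLIntegral_condLExp (𝓕.mono hsu) Q _ hA, ← lintegral_indicator hAu,
    ← lintegral_indicator hAu, ← lintegral_rnDeriv_trim_mul htu hQ.1 (hC.indicator hAt),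
    lintegral_pasting htu Q hR (hY.indicator hAu),
    ← lintegral_trim_scenario htu hR hZC]
  simp only [hind]
  exact lintegral_mul_condLExp (𝓕.mono htu) R (hZ.indicator hAt) hY

/-- Every scenario is the pasting of itself with one of its conditional scenarios. -/
theorem exists_pasting_eq_self (hst : s ≤ t) (htu : t ≤ u) {Q : @Measure Ω (𝓕 u)}
    (hQ : Q ∈ scenarios P 𝓕 (hst.trans htu)) :
    ∃ R ∈ scenarios P 𝓕 htu, pasting P 𝓕 htu Q R = Q := by
  have := isFiniteMeasure_of_mem_scenarios hQ
  set Z := Q.rnDeriv (P.trim (𝓕.le u)) with hZ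
  set Zt := (Q.trim (𝓕.mono htu)).rnDeriv (P.trim (𝓕.le t)) with hZt
  have hZm : Measurable[𝓕 u] Z := Measure.measurable_rnDeriv _ _
  have hZtm : Measurable[𝓕 t] Zt := Measure.measurable_rnDeriv _ _
  have hZtu : Measurable[𝓕 u] Zt := hZtm.mono (𝓕.mono htu) le_rfl
  have hN : MeasurableSet[𝓕 t] {ω | Zt ω = 0} := hZtm (measurableSet_singleton 0)
  have hNu : MeasurableSet[𝓕 u] {ω | Zt ω = 0} := 𝓕.mono htu _ hN
  have hfin : ∀ᵐ ω ∂(P.trim (𝓕.le t)), Zt ω ≠ ∞ := Measure.rnDeriv_ne_top _ _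
  have hQN : Q {ω | Zt ω = 0} = 0 := by
    rw [← lintegral_indicator_one hNu, ← lintegral_rnDeriv_trim_mul htu hQ.1
      (measurable_indicator_one hN)]
    refine lintegral_eq_zero_of_ae_eq_zero (ae_of_all _ fun ω => ?_)
    by_cases h : Zt ω = 0
    · simp [← hZt, h]
    · simp [Set.indicator_of_notMem (s := {ω | Zt ω = 0}) h]
  have hZ0 : ∀ᵐ ω ∂(P.trim (𝓕.le u)), Zt ω = 0 → Z ω = 0 := by
    rw [← Measure.withDensity_rnDeriv_eq _ _ hQ.1, withDensity_apply _ hNu,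
      lintegral_eq_zero_iff hZm] at hQN
    exact (ae_restrict_iff' hNu).1 hQN
  -- The density is Z / Z_t where Z_t ≠ 0, and 1 on {Z_t = 0} so that R still equals P on F_t. On
  -- that null set of Q one has Z = 0 P-a.e., so the second summand is `∞ * 0 = 0`.
  let D : Ω → ℝ≥0∞ := fun ω => {ω | Zt ω = 0}.indicator 1 ω + (Zt ω)⁻¹ * Z ω
  have hDm : Measurable[𝓕 u] D := (measurable_indicator_one hNu).add (hZtu.inv.mul hZm)
  refine ⟨(P.trim (𝓕.le u)).withDensity D, ⟨withDensity_absolutelyContinuous _ _, ?_⟩, ?_⟩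
  · refine @Measure.ext _ (𝓕 t) _ _ fun A hA => ?_
    have hAu := 𝓕.mono htu A hA
    have h1 : ∫⁻ ω in A, (Zt ω)⁻¹ * Z ω ∂(P.trim (𝓕.le u))
        = (P.trim (𝓕.le t)) (A ∩ {ω | Zt ω = 0}ᶜ) := by
      have h2 : ∫⁻ ω in A, (Zt ω)⁻¹ * Z ω ∂(P.trim (𝓕.le u))
          = ∫⁻ ω, Z ω * A.indicator Zt⁻¹ ω ∂(P.trim (𝓕.le u)) := by
        rw [← lintegral_indicator hAu]
        refine lintegral_congr fun ω => ?_
        by_cases h : ω ∈ A <;> simp [h, mul_comm]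
      rw [h2, lintegral_rnDeriv_mul hQ.1 (hZtu.inv.indicator hAu).aemeasurable,
        ← lintegral_rnDeriv_trim_mul htu hQ.1 (hZtm.inv.indicator hA),
        ← lintegral_indicator_one (hA.inter hN.compl)]
      refine lintegral_congr_ae ?_
      filter_upwards [hfin] with ω hω
      by_cases hA : ω ∈ A <;> by_cases h0 : Zt ω = 0
      · simp [hA, h0, ← hZt]
      · simp [hA, h0, ← hZt, ENNReal.mul_inv_cancel h0 hω]
      · simp [hA]
      · simp [hA]
    rw [trim_measurableSet_eq _ hA, withDensity_apply _ hAu,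
      lintegral_add_left (measurable_indicator_one hNu), h1, lintegral_indicator_one hNu,
      Measure.restrict_apply hNu, ← trim_le_trim htu,
      trim_measurableSet_eq _ (hA.inter hN.compl), trim_measurableSet_eq _ hA, Set.inter_comm _ A,
      ← Set.sdiff_eq]
    exact measure_inter_add_sdiff A hNu
  · conv_rhs => rw [← Measure.withDensity_rnDeriv_eq _ _ hQ.1]
    refine withDensity_congr_ae ?_
    filter_upwards [Measure.rnDeriv_withDensity (P.trim (𝓕.le u)) hDm, hZ0,
      ae_trim_of_le htu hfin] with ω h1 h2 h3
    rw [h1]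
    by_cases h0 : Zt ω = 0
    · simp [← hZt, ← hZ, h0, h2 h0]
    · simp [D, ← hZt, ← hZ, h0, ← mul_assoc, ENNReal.mul_inv_cancel h0 h3]

end

namespace RiskMeasure

/-! ### Time-consistency and the cocycle property of penalties -/

variable {P : Measure Ω} {𝓕 : Filtration (Set.Icc (0 : ℝ) T) m} {p : ℝ≥0∞}
  {s t u : Set.Icc (0 : ℝ) T} (ρ : RiskMeasure P 𝓕 p)

theorem coeFn_incl_sub (htu : t ≤ u) (X : LpAt P 𝓕 p u) :
    ∀ᵐ ω ∂(P.trim (𝓕.le u)), (incl htu (ρ.toFun htu 0 - ρ.toFun htu X) : LpAt P 𝓕 p u) ω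
      = ρ.toFun htu 0 ω - ρ.toFun htu X ω := by
  filter_upwards [coeFn_incl htu (ρ.toFun htu 0 - ρ.toFun htu X),
    ae_trim_of_le htu (Lp.coeFn_sub (ρ.toFun htu 0) (ρ.toFun htu X))] with ω h1 h2
  rw [h1, h2, Pi.sub_apply]

variable [IsProbabilityMeasure P]

/-- The penalty of `R` in excess of the minimal penalty. -/
noncomputable def excess (h : t ≤ u) (R : @Measure Ω (𝓕 u)) : Ω → ℝ≥0∞ :=
  fun ω => (ρ.penalty h R ω - ρ.minPenalty h ω).toENNReal

theorem measurable_penalty_add_condLExp_excess (hst : s ≤ t) (htu : t ≤ u)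
    (Q R : @Measure Ω (𝓕 u)) :
    Measurable[𝓕 s] fun ω =>
      ρ.penalty (hst.trans htu) Q ω + (condLExp (𝓕 s) Q (ρ.excess htu R) ω : EReal) :=
  (ρ.measurable_penalty _ Q).add (measurable_condLExp _ _ _).coe_ereal_ennreal

/-- No penalty lies below the minimal one, so the negative part in the extended conditional
expectation vanishes. -/
theorem cocycleRHS_ae_eq [Fact (1 ≤ p)] (hst : s ≤ t) (htu : t ≤ u) {Q R : @Measure Ω (𝓕 u)}
    (hQ : Q ∈ scenarios P 𝓕 (hst.trans htu)) (hR : R ∈ scenarios P 𝓕 htu) :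
    ∀ᵐ ω ∂(P.trim (𝓕.le s)), ρ.cocycleRHS hst htu Q R ω
      = ρ.penalty (hst.trans htu) Q ω + (condLExp (𝓕 s) Q (ρ.excess htu R) ω : EReal) := by
  have h0 : (fun ω => (-(ρ.penalty htu R ω - ρ.minPenalty htu ω)).toENNReal)
      =ᵐ[P.trim (𝓕.le u)] (0 : Ω → ℝ≥0∞) := by
    filter_upwards [ae_trim_of_le htu (neg_toFun_zero_le_penalty (ρ := ρ) hR),
      ae_trim_of_le htu (ρ.minPenalty_ae_eq htu)] with ω h1 h2
    rw [Pi.zero_apply, EReal.toENNReal_eq_zero_iff, EReal.neg_le, neg_zero, h2,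
      EReal.sub_nonneg (Or.inr (EReal.coe_ne_top _)) (Or.inr (EReal.coe_ne_bot _))]
    exact h1
  filter_upwards [condLExp_ae_eq_of_scenario hQ h0] with ω h1
  rw [cocycleRHS, extCondExp, h1, condLExp_zero, Pi.zero_apply, EReal.coe_ennreal_zero, sub_zero]
  rfl

variable {ρ}

theorem condLExp_ne_top (h : s ≤ t) {Q : @Measure Ω (𝓕 t)}
    (hQ : Q ∈ scenarios P 𝓕 h) (X : LpAt P 𝓕 p t) :
    ∀ᵐ ω ∂(P.trim (𝓕.le s)), ρ.penalty h Q ω ≠ ⊤ →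
      condLExp (𝓕 s) Q (fun ω => ENNReal.ofReal (X ω)) ω ≠ ∞ ∧
      condLExp (𝓕 s) Q (fun ω => ENNReal.ofReal (-X ω)) ω ≠ ∞ := by
  filter_upwards [condLExp_abs_ne_top (ρ := ρ) hQ X, condLExp_le_condLExp_abs hQ X]
    with ω h1 h2 h3
  exact ⟨ne_top_of_le_ne_top (h1 h3) h2.2, ne_top_of_le_ne_top (h1 h3) h2.1⟩

/-- The conditional expectation of the absolute value of a position under one of its optimal
scenarios is dominated by an element of `L^p`. -/
theorem exists_condLExp_add_le (htu : t ≤ u) {R : @Measure Ω (𝓕 u)} {X : LpAt P 𝓕 p u}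
    (hR : ρ.IsOptimalScenario htu X R) : ∃ W : LpAt P 𝓕 p t, ∀ᵐ ω ∂(P.trim (𝓕.le t)),
      condLExp (𝓕 t) R (fun ω => ENNReal.ofReal (-X ω)) ω
        + condLExp (𝓕 t) R (fun ω => ENNReal.ofReal (X ω)) ω ≤ ENNReal.ofReal (W ω) := by
  -- The position X - |X| is -2X⁻. Testing the penalty of R with it and substituting the value of
  -- the penalty given by optimality bounds E_R[X⁻ | F_t] + E_R[X⁺ | F_t].
  refine ⟨ρ.toFun htu (X - |X|) - ρ.toFun htu X, ?_⟩
  have hY : ∀ᵐ ω ∂(P.trim (𝓕.le u)), (X - |X| : LpAt P 𝓕 p u) ω = X ω - |X ω| := by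
    filter_upwards [Lp.coeFn_sub X |X|, Lp.coeFn_abs X] with ω h1 h2
    rw [h1, Pi.sub_apply, h2]
  have h1 : (fun ω => ENNReal.ofReal (-(X - |X| : LpAt P 𝓕 p u) ω))
      =ᵐ[P.trim (𝓕.le u)] fun ω => ENNReal.ofReal (-X ω) + ENNReal.ofReal (-X ω) := by
    filter_upwards [hY] with ω h
    rw [h]
    rcases le_total 0 (X ω) with h0 | h0
    · rw [abs_of_nonneg h0, ENNReal.ofReal_of_nonpos (neg_nonpos.2 h0)]
      simp
    · rw [abs_of_nonpos h0, ← ENNReal.ofReal_add (neg_nonneg.2 h0) (neg_nonneg.2 h0)]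
      congr 1
      ring
  have h2 : (fun ω => ENNReal.ofReal ((X - |X| : LpAt P 𝓕 p u) ω))
      =ᵐ[P.trim (𝓕.le u)] (0 : Ω → ℝ≥0∞) := by
    filter_upwards [hY] with ω h
    rw [h, Pi.zero_apply, ENNReal.ofReal_eq_zero, sub_nonpos]
    exact le_abs_self _
  have hX : Measurable[𝓕 u] fun ω => ENNReal.ofReal (-X ω) :=
    (Lp.stronglyMeasurable X).measurable.neg.ennreal_ofReal
  filter_upwards [ρ.sub_toFun_le_penalty htu R (X - |X|), condLExp_ae_eq_of_scenario hR.1 h1,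
    condLExp_ae_eq_of_scenario hR.1 h2, condLExp_add_of_scenario hR.1 hX _,
    ((ρ.isOptimalScenario_iff htu X R).1 hR).2,
    Lp.coeFn_sub (ρ.toFun htu (X - |X|)) (ρ.toFun htu X)] with ω h3 h4 h5 h6 h7 h8
  rw [h4, h5, h6, condLExp_zero, Pi.zero_apply, EReal.coe_ennreal_zero, sub_zero] at h3
  rw [h8, Pi.sub_apply]
  exact add_le_ofReal_of_two_mul_sub_le h7 h3

theorem condLExp_left_ae_eq (hst : s ≤ t) (htu : t ≤ u) {Q R : @Measure Ω (𝓕 u)}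
    (hQ : Q ∈ scenarios P 𝓕 (hst.trans htu)) (hR : R ∈ scenarios P 𝓕 htu) (X : LpAt P 𝓕 p u) :
    condLExp (𝓕 s) Q (fun ω => condLExp (𝓕 t) R (fun ω => ENNReal.ofReal (-X ω)) ω
        + ENNReal.ofReal (ρ.toFun htu 0 ω - ρ.toFun htu X ω)) =ᵐ[P.trim (𝓕.le s)] fun ω =>
      condLExp (𝓕 s) (pasting P 𝓕 htu Q R) (fun ω => ENNReal.ofReal (-X ω)) ω
        + condLExp (𝓕 s) Q (fun ω => ENNReal.ofReal
          ((incl htu (ρ.toFun htu 0 - ρ.toFun htu X) : LpAt P 𝓕 p u) ω)) ω := by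
  have hX : Measurable[𝓕 u] fun ω => ENNReal.ofReal (-X ω) :=
    (Lp.stronglyMeasurable X).measurable.neg.ennreal_ofReal
  have h1 : (fun ω => ENNReal.ofReal
      ((incl htu (ρ.toFun htu 0 - ρ.toFun htu X) : LpAt P 𝓕 p u) ω))
      =ᵐ[P.trim (𝓕.le u)] fun ω => ENNReal.ofReal (ρ.toFun htu 0 ω - ρ.toFun htu X ω) :=
    (ρ.coeFn_incl_sub htu X).mono fun ω h => by simp only [h]
  filter_upwards [condLExp_pasting hst htu hQ hR hX, condLExp_ae_eq_of_scenario hQ h1,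
    condLExp_add_of_scenario hQ ((measurable_condLExp (𝓕 t) R
      fun ω => ENNReal.ofReal (-X ω)).mono (𝓕.mono htu) le_rfl)
      fun ω => ENNReal.ofReal (ρ.toFun htu 0 ω - ρ.toFun htu X ω)] with ω h2 h3 h4
  rw [h2, h3, h4]

theorem condLExp_right_ae_eq (hst : s ≤ t) (htu : t ≤ u) {Q R : @Measure Ω (𝓕 u)}
    (hQ : Q ∈ scenarios P 𝓕 (hst.trans htu)) (hR : R ∈ scenarios P 𝓕 htu) (X : LpAt P 𝓕 p u) :
    condLExp (𝓕 s) Q (fun ω => condLExp (𝓕 t) R (fun ω => ENNReal.ofReal (X ω)) ω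
        + ρ.excess htu R ω + ENNReal.ofReal (-(ρ.toFun htu 0 ω - ρ.toFun htu X ω)))
      =ᵐ[P.trim (𝓕.le s)] fun ω =>
      condLExp (𝓕 s) (pasting P 𝓕 htu Q R) (fun ω => ENNReal.ofReal (X ω)) ω
        + condLExp (𝓕 s) Q (ρ.excess htu R) ω
        + condLExp (𝓕 s) Q (fun ω => ENNReal.ofReal
          (-(incl htu (ρ.toFun htu 0 - ρ.toFun htu X) : LpAt P 𝓕 p u) ω)) ω := by
  have hX : Measurable[𝓕 u] fun ω => ENNReal.ofReal (X ω) :=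
    (Lp.stronglyMeasurable X).measurable.ennreal_ofReal
  have hD : Measurable[𝓕 t] fun ω =>
      ENNReal.ofReal (-(ρ.toFun htu 0 ω - ρ.toFun htu X ω)) :=
    ((Lp.stronglyMeasurable _).measurable.sub
      (Lp.stronglyMeasurable _).measurable).neg.ennreal_ofReal
  have h1 : (fun ω => ENNReal.ofReal
      (-(incl htu (ρ.toFun htu 0 - ρ.toFun htu X) : LpAt P 𝓕 p u) ω))
      =ᵐ[P.trim (𝓕.le u)] fun ω => ENNReal.ofReal (-(ρ.toFun htu 0 ω - ρ.toFun htu X ω)) :=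
    (ρ.coeFn_incl_sub htu X).mono fun ω h => by simp only [h]
  have h5 : (fun ω => condLExp (𝓕 t) R (fun ω => ENNReal.ofReal (X ω)) ω
        + ρ.excess htu R ω + ENNReal.ofReal (-(ρ.toFun htu 0 ω - ρ.toFun htu X ω)))
      = fun ω => condLExp (𝓕 t) R (fun ω => ENNReal.ofReal (X ω)) ω
        + (ENNReal.ofReal (-(ρ.toFun htu 0 ω - ρ.toFun htu X ω)) + ρ.excess htu R ω) := by
    ext ω
    ring
  rw [h5]
  filter_upwards [condLExp_pasting hst htu hQ hR hX, condLExp_ae_eq_of_scenario hQ h1,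
    condLExp_add_of_scenario hQ ((measurable_condLExp (𝓕 t) R
      fun ω => ENNReal.ofReal (X ω)).mono (𝓕.mono htu) le_rfl)
      (fun ω => ENNReal.ofReal (-(ρ.toFun htu 0 ω - ρ.toFun htu X ω)) + ρ.excess htu R ω),
    condLExp_add_of_scenario hQ (hD.mono (𝓕.mono htu) le_rfl) (ρ.excess htu R)]
    with ω h2 h3 h4 h6
  rw [h2, h3, h4, h6]
  ring

/-- This is E_S[-X | F_s] ≤ E_Q[-D | F_s] + E_Q[excess | F_s] with all parts moved to the side where
they are added. It holds without any time-consistency. -/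
theorem condLExp_pasting_add_le [Fact (1 ≤ p)] (hst : s ≤ t) (htu : t ≤ u) {Q R : @Measure Ω (𝓕 u)}
    (hQ : Q ∈ scenarios P 𝓕 (hst.trans htu)) (hR : R ∈ scenarios P 𝓕 htu) (X : LpAt P 𝓕 p u) :
    ∀ᵐ ω ∂(P.trim (𝓕.le s)),
      condLExp (𝓕 s) (pasting P 𝓕 htu Q R) (fun ω => ENNReal.ofReal (-X ω)) ω
        + condLExp (𝓕 s) Q (fun ω => ENNReal.ofReal
          ((incl htu (ρ.toFun htu 0 - ρ.toFun htu X) : LpAt P 𝓕 p u) ω)) ω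
      ≤ condLExp (𝓕 s) (pasting P 𝓕 htu Q R) (fun ω => ENNReal.ofReal (X ω)) ω
        + condLExp (𝓕 s) Q (ρ.excess htu R) ω
        + condLExp (𝓕 s) Q (fun ω => ENNReal.ofReal
          (-(incl htu (ρ.toFun htu 0 - ρ.toFun htu X) : LpAt P 𝓕 p u) ω)) ω := by
  have hle : ∀ᵐ ω ∂(P.trim (𝓕.le t)),
      condLExp (𝓕 t) R (fun ω => ENNReal.ofReal (-X ω)) ω
        + ENNReal.ofReal (ρ.toFun htu 0 ω - ρ.toFun htu X ω)
      ≤ condLExp (𝓕 t) R (fun ω => ENNReal.ofReal (X ω)) ω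
        + ρ.excess htu R ω + ENNReal.ofReal (-(ρ.toFun htu 0 ω - ρ.toFun htu X ω)) := by
    filter_upwards [ρ.sub_toFun_le_penalty htu R X, ρ.minPenalty_ae_eq htu] with ω h1 h2
    rw [excess, h2]
    exact add_ofReal_le_of_sub_le h1
  filter_upwards [condLExp_mono_of_scenario hQ (hQ.1.ae_le (ae_trim_of_le htu hle)),
    condLExp_left_ae_eq (ρ := ρ) hst htu hQ hR X, condLExp_right_ae_eq (ρ := ρ) hst htu hQ hR X]
    with ω h1 h2 h3
  rwa [h2, h3] at h1

theorem condLExp_pasting_add_eq [Fact (1 ≤ p)] (hst : s ≤ t) (htu : t ≤ u) {Q R : @Measure Ω (𝓕 u)}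
    (hQ : Q ∈ scenarios P 𝓕 (hst.trans htu)) {X : LpAt P 𝓕 p u}
    (hR : ρ.IsOptimalScenario htu X R) :
    ∀ᵐ ω ∂(P.trim (𝓕.le s)),
      condLExp (𝓕 s) (pasting P 𝓕 htu Q R) (fun ω => ENNReal.ofReal (-X ω)) ω
        + condLExp (𝓕 s) Q (fun ω => ENNReal.ofReal
          ((incl htu (ρ.toFun htu 0 - ρ.toFun htu X) : LpAt P 𝓕 p u) ω)) ω
      = condLExp (𝓕 s) (pasting P 𝓕 htu Q R) (fun ω => ENNReal.ofReal (X ω)) ω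
        + condLExp (𝓕 s) Q (ρ.excess htu R) ω
        + condLExp (𝓕 s) Q (fun ω => ENNReal.ofReal
          (-(incl htu (ρ.toFun htu 0 - ρ.toFun htu X) : LpAt P 𝓕 p u) ω)) ω := by
  have heq : ∀ᵐ ω ∂(P.trim (𝓕.le t)),
      condLExp (𝓕 t) R (fun ω => ENNReal.ofReal (-X ω)) ω
        + ENNReal.ofReal (ρ.toFun htu 0 ω - ρ.toFun htu X ω)
      = condLExp (𝓕 t) R (fun ω => ENNReal.ofReal (X ω)) ω
        + ρ.excess htu R ω + ENNReal.ofReal (-(ρ.toFun htu 0 ω - ρ.toFun htu X ω)) := by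
    filter_upwards [((ρ.isOptimalScenario_iff htu X R).1 hR).2, ρ.minPenalty_ae_eq htu,
      neg_toFun_zero_le_penalty (ρ := ρ) hR.1] with ω h1 h2 h3
    rw [excess, h2]
    exact add_ofReal_eq_of_eq_sub h1 h3
  filter_upwards [condLExp_ae_eq_of_scenario hQ (ae_trim_of_le htu heq),
    condLExp_left_ae_eq (ρ := ρ) hst htu hQ hR.1 X,
    condLExp_right_ae_eq (ρ := ρ) hst htu hQ hR.1 X] with ω h1 h2 h3
  rwa [h2, h3] at h1

/-- The inner R-expectations are dominated by an element of L^p(F_t), whose Q-expectation is finite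
wherever the penalty of Q is. -/
theorem condLExp_pasting_ne_top (hst : s ≤ t) (htu : t ≤ u) {Q R : @Measure Ω (𝓕 u)}
    (hQ : Q ∈ scenarios P 𝓕 (hst.trans htu)) {X : LpAt P 𝓕 p u}
    (hR : ρ.IsOptimalScenario htu X R) :
    ∀ᵐ ω ∂(P.trim (𝓕.le s)), ρ.penalty (hst.trans htu) Q ω ≠ ⊤ →
      condLExp (𝓕 s) (pasting P 𝓕 htu Q R) (fun ω => ENNReal.ofReal (-X ω)) ω ≠ ∞ ∧
      condLExp (𝓕 s) (pasting P 𝓕 htu Q R) (fun ω => ENNReal.ofReal (X ω)) ω ≠ ∞ := by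
  obtain ⟨W, hW⟩ := exists_condLExp_add_le htu hR
  have hX : Measurable[𝓕 u] fun ω => ENNReal.ofReal (X ω) :=
    (Lp.stronglyMeasurable X).measurable.ennreal_ofReal
  have hX' : Measurable[𝓕 u] fun ω => ENNReal.ofReal (-X ω) :=
    (Lp.stronglyMeasurable X).measurable.neg.ennreal_ofReal
  have hW' : ∀ᵐ ω ∂Q, condLExp (𝓕 t) R (fun ω => ENNReal.ofReal (-X ω)) ω
        + condLExp (𝓕 t) R (fun ω => ENNReal.ofReal (X ω)) ω
        ≤ ENNReal.ofReal ((incl htu W : LpAt P 𝓕 p u) ω) := by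
    filter_upwards [hQ.1.ae_le (ae_trim_of_le htu hW), hQ.1.ae_le (coeFn_incl htu W)]
      with ω h1 h2
    rwa [h2]
  filter_upwards [condLExp_pasting hst htu hQ hR.1 hX, condLExp_pasting hst htu hQ hR.1 hX',
    condLExp_mono_of_scenario hQ (hW'.mono fun ω h => le_self_add.trans h),
    condLExp_mono_of_scenario hQ (hW'.mono fun ω h => le_add_self.trans h),
    condLExp_ne_top (ρ := ρ) (hst.trans htu) hQ (incl htu W)] with ω h1 h2 h3 h4 h5 h6
  rw [h1, h2]
  exact ⟨ne_top_of_le_ne_top (h5 h6).1 h3, ne_top_of_le_ne_top (h5 h6).1 h4⟩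

theorem penalty_pasting_le [Fact (1 ≤ p)] (hρ : ρ.WeaklyTimeConsistent) (hst : s ≤ t) (htu : t ≤ u)
    {Q R : @Measure Ω (𝓕 u)} (hQ : Q ∈ scenarios P 𝓕 (hst.trans htu))
    (hR : R ∈ scenarios P 𝓕 htu) :
    ρ.penalty (hst.trans htu) (pasting P 𝓕 htu Q R)
      ≤ᵐ[P.trim (𝓕.le s)] ρ.cocycleRHS hst htu Q R := by
  have hle := (isEssSup_essSupFamily (P.trim (𝓕.le s)) fun (X : LpAt P 𝓕 p u) ω =>
    extCondExp (𝓕 s) (pasting P 𝓕 htu Q R) (fun ω' => ((-X ω' : ℝ) : EReal)) ω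
      - ((ρ.toFun (hst.trans htu) X ω : ℝ) : EReal)).least _
    (ρ.measurable_penalty_add_condLExp_excess hst htu Q R) (fun X => by
    filter_upwards [condLExp_pasting_add_le (ρ := ρ) hst htu hQ hR X,
      neg_toFun_zero_le_penalty (ρ := ρ) hQ,
      condLExp_ne_top (ρ := ρ) (hst.trans htu) hQ
        (incl htu (ρ.toFun htu 0 - ρ.toFun htu X)),
      ρ.sub_toFun_le_penalty (hst.trans htu) Q
        (incl htu (ρ.toFun htu 0 - ρ.toFun htu X))] with ω h1 h2 h3 h4
    rw [hρ hst htu X] at h4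
    rw [extCondExp_neg_coe]
    exact sub_sub_le_add h1 h2 h3 h4)
  filter_upwards [hle, ρ.cocycleRHS_ae_eq hst htu hQ hR] with ω h1 h2
  rw [h2]
  exact h1

theorem penalty_pasting_eq [Fact (1 ≤ p)] (hρ : ρ.WeaklyTimeConsistent) (hst : s ≤ t) (htu : t ≤ u)
    {Q R : @Measure Ω (𝓕 u)} {X : LpAt P 𝓕 p u}
    (hQ : ρ.IsOptimalScenario (hst.trans htu) (incl htu (ρ.toFun htu 0 - ρ.toFun htu X)) Q)
    (hR : ρ.IsOptimalScenario htu X R) :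
    ρ.penalty (hst.trans htu) (pasting P 𝓕 htu Q R)
      =ᵐ[P.trim (𝓕.le s)] ρ.cocycleRHS hst htu Q R := by
  have hS := pasting_mem_scenarios hst htu hQ.1 hR.1
  filter_upwards [penalty_pasting_le hρ hst htu hQ.1 hR.1,
    ρ.cocycleRHS_ae_eq hst htu hQ.1 hR.1, condLExp_pasting_add_eq hst htu hQ.1 hR,
    ((ρ.isOptimalScenario_iff _ _ Q).1 hQ).2,
    ρ.sub_toFun_le_penalty (hst.trans htu) (pasting P 𝓕 htu Q R) X,
    condLExp_ne_top (ρ := ρ) (hst.trans htu) hS X] with ω h1 h2 h3 h4 h5 h6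
  refine le_antisymm h1 ?_
  rw [h2]
  rw [hρ hst htu X] at h4
  -- If E_S[X⁺ | F_s] is infinite, the penalty of S is `⊤` and there is nothing to prove.
  refine add_le_of_sub_sub_le h3 h4 h5 fun hb => ?_
  by_contra h7
  exact (h6 h7).1 hb

theorem toFun_incl_le_of_cocycle [Fact (1 ≤ p)] (hst : s ≤ t) (htu : t ≤ u)
    (hρ : ∀ Q ∈ scenarios P 𝓕 (hst.trans htu), ∀ R ∈ scenarios P 𝓕 htu,
      ρ.penalty (hst.trans htu) (pasting P 𝓕 htu Q R)
        =ᵐ[P.trim (𝓕.le s)] ρ.cocycleRHS hst htu Q R) (X : LpAt P 𝓕 p u) :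
    ρ.toFun (hst.trans htu) (incl htu (ρ.toFun htu 0 - ρ.toFun htu X))
      ≤ ρ.toFun (hst.trans htu) X := by
  obtain ⟨R, hR, -⟩ := ρ.exists_optimalScenario htu X
  obtain ⟨Q, hQ, -⟩ := ρ.exists_optimalScenario (hst.trans htu)
    (incl htu (ρ.toFun htu 0 - ρ.toFun htu X))
  rw [← Lp.coeFn_le]
  filter_upwards [hρ Q hQ.1 R hR.1, ρ.cocycleRHS_ae_eq hst htu hQ.1 hR.1,
    condLExp_pasting_add_eq hst htu hQ.1 hR, ((ρ.isOptimalScenario_iff _ _ Q).1 hQ).2,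
    ρ.sub_toFun_le_penalty (hst.trans htu) (pasting P 𝓕 htu Q R) X,
    condLExp_pasting_ne_top hst htu hQ.1 hR] with ω h1 h2 h3 h4 h5 h6
  -- Optimality of Q makes its penalty finite, which makes the expectations of X⁺ and X⁻ under S
  -- finite.
  obtain ⟨ha, hb⟩ := h6 (ne_top_of_coe_eq_sub_sub h4).2.2.1
  rw [h1, h2] at h5
  exact le_of_coe_eq_sub_sub h3 ha hb h4 h5

theorem toFun_le_incl_of_cocycle [Fact (1 ≤ p)] (hst : s ≤ t) (htu : t ≤ u)
    (hρ : ∀ Q ∈ scenarios P 𝓕 (hst.trans htu), ∀ R ∈ scenarios P 𝓕 htu,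
      ρ.penalty (hst.trans htu) (pasting P 𝓕 htu Q R)
        =ᵐ[P.trim (𝓕.le s)] ρ.cocycleRHS hst htu Q R) (X : LpAt P 𝓕 p u) :
    ρ.toFun (hst.trans htu) X
      ≤ ρ.toFun (hst.trans htu) (incl htu (ρ.toFun htu 0 - ρ.toFun htu X)) := by
  obtain ⟨Q, hQ, -⟩ := ρ.exists_optimalScenario (hst.trans htu) X
  obtain ⟨R, hR, hS⟩ := exists_pasting_eq_self hst htu hQ.1
  have h1 := hρ Q hQ.1 R hR
  have h2 := condLExp_pasting_add_le (ρ := ρ) hst htu hQ.1 hR X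
  rw [hS] at h1 h2
  rw [← Lp.coeFn_le]
  filter_upwards [h1, h2, ρ.cocycleRHS_ae_eq hst htu hQ.1 hR,
    ((ρ.isOptimalScenario_iff _ _ Q).1 hQ).2,
    ρ.sub_toFun_le_penalty (hst.trans htu) Q (incl htu (ρ.toFun htu 0 - ρ.toFun htu X)),
    condLExp_ne_top (ρ := ρ) (hst.trans htu) hQ.1
      (incl htu (ρ.toFun htu 0 - ρ.toFun htu X))] with ω h1 h2 h3 h4 h5 h6
  -- As S = Q, the cocycle identity reads α = α + E_Q[excess | F_s] with α finite, so the excess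
  -- term disappears from `h2`.
  exact le_of_coe_eq_sub_sub_self h2 h4 (h1.trans h3) h6 h5

end RiskMeasure

end FullyDynamic

theorem mainTheorem10 {Ω : Type*} {m : MeasurableSpace Ω} (P : Measure Ω)
    [IsProbabilityMeasure P] {T : ℝ} (𝓕 : Filtration (Set.Icc (0 : ℝ) T) m)
    (p : ℝ≥0∞) (hp : 1 ≤ p) (ρ : FullyDynamic.RiskMeasure P 𝓕 p) :
    -- the pasted measures are scenarios
    (∀ ⦃s t u : Set.Icc (0 : ℝ) T⦄ (hst : s ≤ t) (htu : t ≤ u),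
      ∀ Q ∈ FullyDynamic.scenarios P 𝓕 (hst.trans htu), ∀ R ∈ FullyDynamic.scenarios P 𝓕 htu,
        FullyDynamic.pasting P 𝓕 htu Q R ∈ FullyDynamic.scenarios P 𝓕 (hst.trans htu)) ∧
    -- a)
    ((∀ ⦃s t u : Set.Icc (0 : ℝ) T⦄ (hst : s ≤ t) (htu : t ≤ u),
      ∀ Q ∈ FullyDynamic.scenarios P 𝓕 (hst.trans htu), ∀ R ∈ FullyDynamic.scenarios P 𝓕 htu,
        ρ.penalty (hst.trans htu) (FullyDynamic.pasting P 𝓕 htu Q R)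
          =ᵐ[P.trim (𝓕.le s)] ρ.cocycleRHS hst htu Q R) →
      ρ.WeaklyTimeConsistent) ∧
    -- b)
    (ρ.WeaklyTimeConsistent →
      ∀ ⦃s t u : Set.Icc (0 : ℝ) T⦄ (hst : s ≤ t) (htu : t ≤ u),
        (∀ Q ∈ FullyDynamic.scenarios P 𝓕 (hst.trans htu), ∀ R ∈ FullyDynamic.scenarios P 𝓕 htu,
          ρ.penalty (hst.trans htu) (FullyDynamic.pasting P 𝓕 htu Q R)
            ≤ᵐ[P.trim (𝓕.le s)] ρ.cocycleRHS hst htu Q R) ∧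
        ∀ X : FullyDynamic.LpAt P 𝓕 p u,
          (∃ Q R : @Measure Ω (𝓕 u),
            ρ.IsOptimalScenario (hst.trans htu)
              (FullyDynamic.incl htu (ρ.toFun htu 0 - ρ.toFun htu X)) Q ∧
            ρ.HasFiniteMeanPenalty (hst.trans htu) Q ∧
            ρ.IsOptimalScenario htu X R ∧ ρ.HasFiniteMeanPenalty htu R) ∧
          ∀ Q R : @Measure Ω (𝓕 u),
            ρ.IsOptimalScenario (hst.trans htu)
              (FullyDynamic.incl htu (ρ.toFun htu 0 - ρ.toFun htu X)) Q →
            ρ.IsOptimalScenario htu X R →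
            ρ.penalty (hst.trans htu) (FullyDynamic.pasting P 𝓕 htu Q R)
              =ᵐ[P.trim (𝓕.le s)] ρ.cocycleRHS hst htu Q R) := by
  have : Fact (1 ≤ p) := ⟨hp⟩
  refine ⟨fun s t u hst htu Q hQ R hR => FullyDynamic.pasting_mem_scenarios hst htu hQ hR,
    fun hρ s t u hst htu X => ?_, fun hρ s t u hst htu => ⟨fun Q hQ R hR => ?_, fun X => ⟨?_, ?_⟩⟩⟩
  · exact le_antisymm
      (FullyDynamic.RiskMeasure.toFun_incl_le_of_cocycle hst htu (hρ hst htu) X)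
      (FullyDynamic.RiskMeasure.toFun_le_incl_of_cocycle hst htu (hρ hst htu) X)
  · exact FullyDynamic.RiskMeasure.penalty_pasting_le hρ hst htu hQ hR
  · obtain ⟨Q, hQ, hQ'⟩ := ρ.exists_optimalScenario (hst.trans htu)
      (FullyDynamic.incl htu (ρ.toFun htu 0 - ρ.toFun htu X))
    obtain ⟨R, hR, hR'⟩ := ρ.exists_optimalScenario htu X
    exact ⟨Q, R, hQ, hQ', hR, hR'⟩
  · exact fun Q R hQ hR => FullyDynamic.RiskMeasure.penalty_pasting_eq hρ hst htu hQ hR
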